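/- **Setting.** Let $T\ge 1$, let $\Omega_{\rm loc}\subseteq\mathbb R^d$ be closed, $\Omega^t=\Omega_{\rm loc}^t$ ($\Omega^0$ is a single point), $\Omega=\Omega^T$, all with their Borel $\sigma$-algebras; $\|\cdot\|$ is the Euclidean norm. Fix $p\in\mathbb N_0$. Let $\mathcal M_1^q(\Omega_{\rm loc})$ be the set of Borel probability measures on $\Omega_{\rm loc}$ with finite $q$-th moment, with the topology $\tau_q$ generated by the maps $\mu\mapsto\int g\,d\mu$, where $g$ is continuous and $|g(x)|\le C(1+\|x\|^q)$ for some $C$; write $\mathcal M_1=\mathcal M_1^0$. Let $d_{W_1}(\mu,\nu)=\inf_\pi\int\|x-y\|\,\pi(dx,dy)$, the infimum being over all couplings $\pi$ of $\mu$ and $\nu$. For $0\le t\le T-1$ let $m_t\in\mathbb N$ and let $\mathcal A_t(\omega^t)\subseteq\mathbb R^{m_t}$ and $\mathcal P_t(\omega^t)\subseteq\mathcal M_1(\Omega_{\rm loc})$, $\omega^t=(\omega_1,\dots,\omega_t)\in\Omega^t$, be set-valued maps (for $t=0$: sets $\mathcal A_0$, $\mathcal P_0$). For $s\le t+1$ let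 $\Omega^t\times\mathcal A^s$ be the set of all $((\omega_1,\dots,\omega_t),(a_0,\dots,a_{s-1}))$ with $\omega_i\in\Omega_{\rm loc}$ and $a_i\in\mathcal A_i(\omega_1,\dots,\omega_i)$ for $i<s$; let $\Psi:\Omega\times\mathcal A^T\to\mathbb R$. Assume: * *Controls.* $\mathcal A_0$ is non-empty and compact. For $1\le t\le T-1$, $\mathcal A_t$ is non-empty, compact-valued and upper hemicontinuous, and there is $L\ge0$ such that for all $\omega^t,\tilde\omega^t\in\Omega^t$ and $a\in\mathcal A_t(\omega^t)$ there is $\tilde a\in\mathcal A_t(\tilde\omega^t)$ with $\|a-\tilde a\|\le L\sum_{i=1}^t\|\omega_i-\tilde\omega_i\|$. * *Objective.* There are $L\ge0$, $\alpha\in(0,1]$, $C\ge1$ such that on $\Omega\times\mathcal A^T$: $|\Psi(\omega,a)-\Psi(\tilde\omega,\tilde a)|\le L\sum_{i=1}^T(\|\omega_i-\tilde\omega_i\|^\alpha+\|a_{i-1}-\tilde a_{i-1}\|^\alpha)$ and $|\Psi(\omega,a)|\le C(1+\sum_{i=1}^T\|\omega_i\|^p)$. * *Ambiguity.* $\mathcal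 P_0\subseteq\mathcal M_1^p(\Omega_{\rm loc})$ is non-empty and $\tau_p$-compact, and $\int\|x\|^p\,d\mu\le C_0$ for all $\mu\in\mathcal P_0$ and some $C_0\ge1$. For $1\le t\le T-1$, $\mathcal P_t$ has values in $\mathcal M_1^p(\Omega_{\rm loc})$ (if $p=0$, also in $\mathcal M_1^1(\Omega_{\rm loc})$), is non-empty, compact-valued, upper and lower hemicontinuous for $\tau_p$; there is $C_t\ge1$ with $\int\|x\|^p\,d\mu\le C_t(1+\sum_{i=1}^t\|\omega_i\|^p)$ for all $\omega^t$ and $\mu\in\mathcal P_t(\omega^t)$; and there is $L_t\ge0$ such that for all $\omega^t,\tilde\omega^t$ and $\mu\in\mathcal P_t(\omega^t)$ there is $\tilde\mu\in\mathcal P_t(\tilde\omega^t)$ with $d_{W_1}(\mu,\tilde\mu)\le L_t\sum_{i=1}^t\|\omega_i-\tilde\omega_i\|$. Let $\mathfrak A$ be the set of $\mathbf a=(a_t)_{t<T}$ with $a_t:\Omega^t\to\mathbb R^{m_t}$ measurable and $a_t(\omega^t)\in\mathcal A_t(\omega^t)$ for all $\omega^t$, and $\mathfrak P$ the set of measures $\mathbb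 P_0\otimes\dots\otimes\mathbb P_{T-1}$ on $\Omega$ with measurable kernels $\mathbb P_t:\Omega^t\to\mathcal M_1(\Omega_{\rm loc})$, $\mathbb P_t(\omega^t)\in\mathcal P_t(\omega^t)$ for all $\omega^t$. Write $\mathbb E_{\mathbb P}[\Psi(\mathbf a)]=\int_\Omega\Psi(\omega,(a_t(\omega_1,\dots,\omega_t))_{t<T})\,\mathbb P(d\omega)$. Put $\Psi_T=\Psi$ and, for $t=T-1,\dots,0$, $$J_t(\omega^t,a^{t+1})=\inf_{\mu\in\mathcal P_t(\omega^t)}\int_{\Omega_{\rm loc}}\Psi_{t+1}((\omega^t,x),a^{t+1})\,\mu(dx),\qquad \Psi_t(\omega^t,a^t)=\sup_{\tilde a\in\mathcal A_t(\omega^t)}J_t(\omega^t,(a^t,\tilde a))$$ on $\Omega^t\times\mathcal A^{t+1}$ and $\Omega^t\times\mathcal A^t$; $\Psi_0$ is a number and $J_0$ a function on $\mathcal A_0$. **Theorem.** All these expectations exist, and all the infima and suprema, here and in (ii), are finite. Moreover: (i) For each $0\le t\le T-1$ there are a measurable $\tilde a_t^*:\Omega^t\times\mathcal A^t\to\mathbb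 R^{m_t}$ with $\tilde a_t^*(\omega^t,a^t)\in\mathcal A_t(\omega^t)$ and $\Psi_t(\omega^t,a^t)=J_t(\omega^t,(a^t,\tilde a_t^*(\omega^t,a^t)))$ for all $(\omega^t,a^t)$ (for $t=0$: a point $a_0^*\in\mathcal A_0$ with $\Psi_0=J_0(a_0^*)$), and a measurable $\tilde{\mathbb P}_t^*:\Omega^t\times\mathcal A^{t+1}\to\mathcal M_1(\Omega_{\rm loc})$ with $\tilde{\mathbb P}_t^*(\omega^t,a^{t+1})\in\mathcal P_t(\omega^t)$ and $\int\Psi_{t+1}((\omega^t,x),a^{t+1})\,\tilde{\mathbb P}^*_t(\omega^t,a^{t+1})(dx)=J_t(\omega^t,a^{t+1})$ for all $(\omega^t,a^{t+1})$. (ii) Let $\tilde a_t^*,\tilde{\mathbb P}_t^*$, $0\le t\le T-1$, be any selectors as in (i), and define recursively $a_t^*(\omega^t)=\tilde a_t^*(\omega^t,(a_0^*,\dots,a_{t-1}^*(\omega_1,\dots,\omega_{t-1})))$ and $\mathbb P_t^*(\omega^t)=\tilde{\mathbb P}_t^*(\omega^t,(a_s^*(\omega_1,\dots,\omega_s))_{s=0,\dots,t})$.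 Then $\mathbf a^*=(a_t^*)_{t<T}\in\mathfrak A$, $\mathbb P^*=\mathbb P_0^*\otimes\dots\otimes\mathbb P_{T-1}^*\in\mathfrak P$, and $$\sup_{\mathbf a\in\mathfrak A}\inf_{\mathbb P\in\mathfrak P}\mathbb E_{\mathbb P}[\Psi(\mathbf a)]=\inf_{\mathbb P\in\mathfrak P}\mathbb E_{\mathbb P}[\Psi(\mathbf a^*)]=\mathbb E_{\mathbb P^*}[\Psi(\mathbf a^*)]=\Psi_0 .$$ -/

import Mathlib

open MeasureTheory Filter
open scoped Topology

noncomputable section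

namespace RobustControl

/-- The Euclidean space `ℝᵏ` with the Euclidean norm. -/
abbrev E (k : ℕ) : Type := EuclideanSpace ℝ (Fin k)

/-- Observation histories `ω^t = (ω_1, …, ω_t) ∈ Ω^t = Ω_loc × ⋯ × Ω_loc`; the `i`-th entry
(counted from `0`) is `ω_{i+1}`. The space `Ω^0` has exactly one point. -/
abbrev Hist {d : ℕ} (Ωloc : Set (E d)) (t : ℕ) : Type := Fin t → Ωloc

/-- Tuples of actions `(a_0, …, a_{t-1}) ∈ ℝ^{m_0} × ⋯ × ℝ^{m_{t-1}}`. -/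
abbrev Acts (m : ℕ → ℕ) (t : ℕ) : Type := (i : Fin t) → E (m i)

variable {d : ℕ} {Ωloc : Set (E d)} {m : ℕ → ℕ}

/-- The first `k` observations of a history. -/
def pre {t : ℕ} (ω : Hist Ωloc t) (k : ℕ) (h : k ≤ t) : Hist Ωloc k :=
  fun j => ω (Fin.castLE h j)

/-- The history `ω^t ⊗_t x = (ω_1, …, ω_t, x)`. -/
def extHist {t : ℕ} (ω : Hist Ωloc t) (x : Ωloc) : Hist Ωloc (t + 1) :=
  Fin.snoc (α := fun _ => Ωloc) ω x

/-- The action tuple `(a_0, …, a_{t-1}, x)`. -/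
def extActs {t : ℕ} (a : Acts m t) (x : E (m t)) : Acts m (t + 1) :=
  Fin.snoc (α := fun i : Fin (t + 1) => E (m i)) a x

/-! ### Measures with moments, the topology `τ_q`, and the Wasserstein distance of order one -/

/-- `μ` has a finite `q`-th moment. -/
def HasMoment (q : ℕ) (μ : ProbabilityMeasure Ωloc) : Prop :=
  Integrable (fun x : Ωloc => ‖(x : E d)‖ ^ q) (μ : Measure Ωloc)

/-- The set of probability measures on `Ω_loc` with finite `q`-th moment, as a type of its own,
since it carries the topology `τ_q` and not the subspace topology of weak convergence. -/
def MomentMeasure (Ωloc : Set (E d)) (q : ℕ) : Type :=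
  {μ : ProbabilityMeasure Ωloc // HasMoment q μ}

/-- The space `C_q(Ω_loc, ℝ)` of continuous functions with growth of degree at most `q`. -/
def PolyGrowth (Ωloc : Set (E d)) (q : ℕ) : Set (Ωloc → ℝ) :=
  {g | Continuous g ∧ ∃ C : ℝ, ∀ x, |g x| ≤ C * (1 + ‖(x : E d)‖ ^ q)}

/-- The topology `τ_q`: the coarsest one for which all maps `μ ↦ ∫ g dμ` with
`g ∈ C_q(Ω_loc, ℝ)` are continuous. -/
instance instTopologicalSpaceMomentMeasure (q : ℕ) : TopologicalSpace (MomentMeasure Ωloc q) :=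
  ⨅ g : PolyGrowth Ωloc q, TopologicalSpace.induced
    (fun μ : MomentMeasure Ωloc q => ∫ x, (g : Ωloc → ℝ) x ∂(μ.1 : Measure Ωloc)) inferInstance

/-- Convergence in `τ_q` is convergence of all integrals of functions in `C_q(Ω_loc, ℝ)`. -/
theorem tendsto_momentMeasure_iff {q : ℕ} {ι : Type*} {l : Filter ι}
    {μ : ι → MomentMeasure Ωloc q} {ν : MomentMeasure Ωloc q} :
    Tendsto μ l (𝓝 ν) ↔ ∀ g ∈ PolyGrowth Ωloc q,
      Tendsto (fun i => ∫ x, g x ∂((μ i).1 : Measure Ωloc)) l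
        (𝓝 (∫ x, g x ∂(ν.1 : Measure Ωloc))) := by
  simp only [nhds_iInf, nhds_induced, tendsto_iInf, tendsto_comap_iff, Subtype.forall]
  rfl

/-- Given a set `Q` of probability measures, its part inside `M_1^q(Ω_loc)`; if all elements of
`Q` have finite `q`-th moment, this is `Q` itself, regarded as a subset of `(M_1^q, τ_q)`. -/
def inMoment (q : ℕ) (Q : Set (ProbabilityMeasure Ωloc)) : Set (MomentMeasure Ωloc q) :=
  {μ | μ.1 ∈ Q}

/-- Joint distributions with marginals `μ` and `ν`. -/
def couplings (μ ν : ProbabilityMeasure Ωloc) : Set (Measure (Ωloc × Ωloc)) :=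
  {π | π.map Prod.fst = (μ : Measure Ωloc) ∧ π.map Prod.snd = (ν : Measure Ωloc)}

/-- The Wasserstein distance of order one, with values in `[0, ∞]`. -/
def W1 (μ ν : ProbabilityMeasure Ωloc) : ENNReal :=
  ⨅ π ∈ couplings μ ν, ∫⁻ z, ENNReal.ofReal ‖(z.1 : E d) - (z.2 : E d)‖ ∂π

/-! ### Data of the control problem

`A t : Ω^t ↠ ℝ^{m_t}` are the control correspondences, `P t : Ω^t ↠ M_1(Ω_loc)` the ambiguity
correspondences. Only the times `t = 0, …, T-1` matter; for `t = 0` a correspondence on the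
one-point space `Ω^0` is just a set. -/

variable (A : (t : ℕ) → Hist Ωloc t → Set (E (m t)))
variable (P : (t : ℕ) → Hist Ωloc t → Set (ProbabilityMeasure Ωloc))

/-- The set `Ω^t × 𝒜^s`, for `s ≤ t + 1`, of all `((ω_1, …, ω_t), (a_0, …, a_{s-1}))` with
`a_i ∈ A_i(ω_1, …, ω_i)` for all `i < s`. -/
def graph (t s : ℕ) (h : s ≤ t + 1) : Set (Hist Ωloc t × Acts m s) :=
  {z | ∀ i : Fin s, z.2 i ∈ A i (pre z.1 i (by have := i.isLt; omega))}

/-- Assumptions on the control sets. -/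
structure ControlAssumption (T : ℕ) : Prop where
  nonempty : ∀ t, 1 ≤ t → t < T → ∀ ω, (A t ω).Nonempty
  compact : ∀ t, 1 ≤ t → t < T → ∀ ω, IsCompact (A t ω)
  upper : ∀ t, 1 ≤ t → t < T → UpperHemicontinuous (A t)
  lipschitz : ∀ t, 1 ≤ t → t < T → ∃ L : ℝ, 0 ≤ L ∧ ∀ ω ω' : Hist Ωloc t,
    ∀ a ∈ A t ω, ∃ a' ∈ A t ω', ‖a - a'‖ ≤ L * ∑ i, ‖(ω i : E d) - (ω' i : E d)‖
  nonempty_zero : ∀ ω, (A 0 ω).Nonempty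
  compact_zero : ∀ ω, IsCompact (A 0 ω)

/-- Assumptions on the objective function: Hölder continuity and polynomial growth on `Ω × 𝒜^T`. -/
structure ObjectiveAssumption (T p : ℕ) (Ψ : Hist Ωloc T → Acts m T → ℝ) : Prop where
  holder : ∃ L α : ℝ, 0 ≤ L ∧ 0 < α ∧ α ≤ 1 ∧
    ∀ z ∈ graph A T T (Nat.le_succ T), ∀ z' ∈ graph A T T (Nat.le_succ T),
      |Ψ z.1 z.2 - Ψ z'.1 z'.2| ≤
        L * ∑ i : Fin T, (‖(z.1 i : E d) - (z'.1 i : E d)‖ ^ α + ‖z.2 i - z'.2 i‖ ^ α)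
  growth : ∃ C : ℝ, 1 ≤ C ∧ ∀ z ∈ graph A T T (Nat.le_succ T),
      |Ψ z.1 z.2| ≤ C * (1 + ∑ i : Fin T, ‖(z.1 i : E d)‖ ^ p)

/-- Assumptions on the ambiguity correspondences. -/
structure AmbiguityAssumption (T p : ℕ) : Prop where
  moment : ∀ t, 1 ≤ t → t < T → ∀ ω, ∀ μ ∈ P t ω, HasMoment p μ
  nonempty : ∀ t, 1 ≤ t → t < T → ∀ ω, (P t ω).Nonempty
  compact : ∀ t, 1 ≤ t → t < T → ∀ ω, IsCompact (inMoment p (P t ω))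
  upper : ∀ t, 1 ≤ t → t < T → UpperHemicontinuous (fun ω => inMoment p (P t ω))
  lower : ∀ t, 1 ≤ t → t < T → LowerHemicontinuous (fun ω => inMoment p (P t ω))
  moment_one : p = 0 → ∀ t, 1 ≤ t → t < T → ∀ ω, ∀ μ ∈ P t ω, HasMoment 1 μ
  moment_bound : ∀ t, 1 ≤ t → t < T → ∃ C : ℝ, 1 ≤ C ∧ ∀ ω : Hist Ωloc t, ∀ μ ∈ P t ω,
    ∫ x, ‖(x : E d)‖ ^ p ∂(μ : Measure Ωloc) ≤ C * (1 + ∑ i, ‖(ω i : E d)‖ ^ p)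
  lipschitz : ∀ t, 1 ≤ t → t < T → ∃ L : ℝ, 0 ≤ L ∧ ∀ ω ω' : Hist Ωloc t,
    ∀ μ ∈ P t ω, ∃ μ' ∈ P t ω',
      W1 μ μ' ≤ ENNReal.ofReal (L * ∑ i, ‖(ω i : E d) - (ω' i : E d)‖)
  moment_zero : ∀ ω, ∀ μ ∈ P 0 ω, HasMoment p μ
  nonempty_zero : ∀ ω, (P 0 ω).Nonempty
  compact_zero : ∀ ω, IsCompact (inMoment p (P 0 ω))
  moment_bound_zero : ∃ C : ℝ, 1 ≤ C ∧ ∀ ω, ∀ μ ∈ P 0 ω,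
    ∫ x, ‖(x : E d)‖ ^ p ∂(μ : Measure Ωloc) ≤ C

/-! ### Admissible controls and admissible measures -/

/-- The actions `(a_0, a_1(ω_1), …, a_{t-1}(ω_1, …, ω_{t-1}))` which a control plays along `ω^t`. -/
def along (a : (t : ℕ) → Hist Ωloc t → E (m t)) (t : ℕ) (ω : Hist Ωloc t) : Acts m t :=
  fun i => a i (pre ω i i.isLt.le)

/-- The set `𝔄` of controls: measurable maps `a_t` with `a_t(·) ∈ A_t(·)`, `t = 0, …, T-1`. -/
def controls (T : ℕ) : Set ((t : ℕ) → Hist Ωloc t → E (m t)) :=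
  {a | ∀ t < T, Measurable (a t) ∧ ∀ ω, a t ω ∈ A t ω}

/-- Families of measurable kernels `P_t : Ω^t → M_1(Ω_loc)` with `P_t(·) ∈ 𝒫_t(·)`,
`t = 0, …, T-1`. -/
def kernels (T : ℕ) : Set ((t : ℕ) → Hist Ωloc t → ProbabilityMeasure Ωloc) :=
  {K | ∀ t < T, Measurable (K t) ∧ ∀ ω, K t ω ∈ P t ω}

/-- The measure `P_0 ⊗ ⋯ ⊗ P_{t-1}` on `Ω^t`: start from the unique point of `Ω^0`, and
given `ω^s` draw the next observation from `P_s(ω^s)`. -/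
def pathMeasure (K : (t : ℕ) → Hist Ωloc t → ProbabilityMeasure Ωloc) :
    (t : ℕ) → Measure (Hist Ωloc t)
  | 0 => Measure.dirac default
  | t + 1 => (pathMeasure K t).bind fun ω => (K t ω : Measure Ωloc).map (extHist ω)

/-- The set `𝔓` of all `P_0 ⊗ ⋯ ⊗ P_{T-1}`. -/
def measures (T : ℕ) : Set (Measure (Hist Ωloc T)) :=
  {μ | ∃ K ∈ kernels P T, μ = pathMeasure K T}

/-! ### The dynamic programming recursion -/

/-- `(ω^t, a^{t+1}) ↦ inf_{μ ∈ 𝒫_t(ω^t)} 𝔼_μ[f(ω^t ⊗_t ·, a^{t+1})]`. -/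
def worstCase {t : ℕ} (f : Hist Ωloc (t + 1) → Acts m (t + 1) → ℝ)
    (ω : Hist Ωloc t) (a : Acts m (t + 1)) : ℝ :=
  ⨅ μ : P t ω, ∫ x, f (extHist ω x) a ∂((μ : ProbabilityMeasure Ωloc) : Measure Ωloc)

/-- `(ω^t, a^t) ↦ sup_{x ∈ A_t(ω^t)} g(ω^t, (a^t, x))`. -/
def bestAction {t : ℕ} (g : Hist Ωloc t → Acts m (t + 1) → ℝ)
    (ω : Hist Ωloc t) (a : Acts m t) : ℝ :=
  ⨆ x : A t ω, g ω (extActs a x)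

/-- The functions `Ψ_t`, `0 ≤ t ≤ T`, defined backwards in time by `Ψ_T = Ψ` and
`Ψ_t(ω^t, a^t) = sup_{x ∈ A_t(ω^t)} J_t(ω^t, (a^t, x))`. -/
def valueFn {T : ℕ} (Ψ : Hist Ωloc T → Acts m T → ℝ) (t : ℕ) (ht : t ≤ T) :
    Hist Ωloc t → Acts m t → ℝ :=
  Nat.decreasingInduction (motive := fun t _ => Hist Ωloc t → Acts m t → ℝ)
    (fun _ _ f => bestAction A (worstCase P f)) Ψ ht

/-- The functions `J_t`, `0 ≤ t < T`:
`J_t(ω^t, a^{t+1}) = inf_{μ ∈ 𝒫_t(ω^t)} 𝔼_μ[Ψ_{t+1}(ω^t ⊗_t ·, a^{t+1})]`. -/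
def J {T : ℕ} (Ψ : Hist Ωloc T → Acts m T → ℝ) (t : ℕ) (ht : t < T) :
    Hist Ωloc t → Acts m (t + 1) → ℝ :=
  worstCase P (valueFn A P Ψ (t + 1) ht)

theorem valueFn_last {T : ℕ} (Ψ : Hist Ωloc T → Acts m T → ℝ) :
    valueFn A P Ψ T le_rfl = Ψ := by
  simp [valueFn]

theorem valueFn_step {T : ℕ} (Ψ : Hist Ωloc T → Acts m T → ℝ) (t : ℕ) (ht : t < T) :
    valueFn A P Ψ t ht.le = bestAction A (J A P Ψ t ht) := by
  unfold valueFn J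
  exact Nat.decreasingInduction_succ_left _ _ ht ht.le

/-- `Ψ_0`, a number. -/
def value {T : ℕ} (Ψ : Hist Ωloc T → Acts m T → ℝ) : ℝ :=
  valueFn A P Ψ 0 (Nat.zero_le T) default default

/-! ### One-step optimizers and their composition -/

/-- `ã_t` is a measurable selector on `Ω^t × 𝒜^t` of `A_t` which attains the supremum defining
`Ψ_t`. (For `t = 0`, it is a point of `A_0` maximizing `J_0`.) -/
structure IsOptimalSelector {T : ℕ} (Ψ : Hist Ωloc T → Acts m T → ℝ) (t : ℕ) (ht : t < T)
    (ã : Hist Ωloc t → Acts m t → E (m t)) : Prop where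
  measurable : Measurable fun z : graph A t t (Nat.le_succ t) => ã z.1.1 z.1.2
  mem : ∀ z ∈ graph A t t (Nat.le_succ t), ã z.1 z.2 ∈ A t z.1
  optimal : ∀ z ∈ graph A t t (Nat.le_succ t),
    valueFn A P Ψ t ht.le z.1 z.2 = J A P Ψ t ht z.1 (extActs z.2 (ã z.1 z.2))

/-- `Q_t` is a measurable selector on `Ω^t × 𝒜^{t+1}` of `𝒫_t` which attains the infimum
defining `J_t`. -/
structure IsWorstCaseSelector {T : ℕ} (Ψ : Hist Ωloc T → Acts m T → ℝ) (t : ℕ) (ht : t < T)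
    (Q : Hist Ωloc t → Acts m (t + 1) → ProbabilityMeasure Ωloc) : Prop where
  measurable : Measurable fun z : graph A t (t + 1) le_rfl => Q z.1.1 z.1.2
  mem : ∀ z ∈ graph A t (t + 1) le_rfl, Q z.1 z.2 ∈ P t z.1
  worst : ∀ z ∈ graph A t (t + 1) le_rfl,
    ∫ x, valueFn A P Ψ (t + 1) ht (extHist z.1 x) z.2 ∂(Q z.1 z.2 : Measure Ωloc) =
      ⨅ μ : P t z.1, ∫ x, valueFn A P Ψ (t + 1) ht (extHist z.1 x) z.2
        ∂((μ : ProbabilityMeasure Ωloc) : Measure Ωloc)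

/-- The control `a*` composed from one-step selectors:
`a*_t(ω^t) = ã_t(ω^t, (a*_0, …, a*_{t-1}(ω_1, …, ω_{t-1})))`. -/
def composeControl (ã : (t : ℕ) → Hist Ωloc t → Acts m t → E (m t)) (t : ℕ)
    (ω : Hist Ωloc t) : E (m t) :=
  ã t ω fun i => composeControl ã i (pre ω i i.isLt.le)
termination_by t
decreasing_by exact i.isLt

theorem composeControl_eq (ã : (t : ℕ) → Hist Ωloc t → Acts m t → E (m t)) (t : ℕ)
    (ω : Hist Ωloc t) :
    composeControl ã t ω = ã t ω (along (composeControl ã) t ω) := by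
  rw [composeControl]; rfl

/-- The kernels `P*_t(ω^t) = Q_t(ω^t, (a_s(ω^s))_{s = 0, …, t})`. -/
def composeKernel (Q : (t : ℕ) → Hist Ωloc t → Acts m (t + 1) → ProbabilityMeasure Ωloc)
    (a : (t : ℕ) → Hist Ωloc t → E (m t)) (t : ℕ) (ω : Hist Ωloc t) : ProbabilityMeasure Ωloc :=
  Q t ω (extActs (along a t ω) (a t ω))

/-- `𝔼_μ[Ψ(a_0, …, a_{T-1})]`. -/
def expectedObjective {T : ℕ} (Ψ : Hist Ωloc T → Acts m T → ℝ) (μ : Measure (Hist Ωloc T))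
    (a : (t : ℕ) → Hist Ωloc t → E (m t)) : ℝ :=
  ∫ ω, Ψ ω (along a T ω) ∂μ

/-- All expectations, infima and suprema in the one-step problems and in the robust control
problem are finite: the integrands are integrable, the infima are over sets bounded below, and the
suprema over sets bounded above. -/
structure WellPosed {T : ℕ} (Ψ : Hist Ωloc T → Acts m T → ℝ) : Prop where
  step_integrable : ∀ t (ht : t < T), ∀ z ∈ graph A t (t + 1) le_rfl, ∀ μ ∈ P t z.1,
    Integrable (fun x => valueFn A P Ψ (t + 1) ht (extHist z.1 x) z.2) (μ : Measure Ωloc)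
  step_bddBelow : ∀ t (ht : t < T), ∀ z ∈ graph A t (t + 1) le_rfl,
    BddBelow (Set.range fun μ : P t z.1 =>
      ∫ x, valueFn A P Ψ (t + 1) ht (extHist z.1 x) z.2
        ∂((μ : ProbabilityMeasure Ωloc) : Measure Ωloc))
  step_bddAbove : ∀ t (ht : t < T), ∀ z ∈ graph A t t (Nat.le_succ t),
    BddAbove (Set.range fun x : A t z.1 => J A P Ψ t ht z.1 (extActs z.2 x))
  integrable : ∀ a ∈ controls A T, ∀ μ ∈ measures P T,
    Integrable (fun ω => Ψ ω (along a T ω)) μ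
  bddBelow : ∀ a ∈ controls A T,
    BddBelow (Set.range fun μ : measures P T => expectedObjective Ψ μ a)
  bddAbove : BddAbove (Set.range fun a : controls A T =>
    ⨅ μ : measures P T, expectedObjective Ψ μ a)

end RobustControl

end

noncomputable section

namespace RobustControl

/-! The proof is backward induction followed by verification. Admissible laws are compositions of
arbitrary measurable kernels with values in `P t`, and the law may be chosen after the control is
known. Hence no minimax theorem is needed: it suffices that each one-step infimum and supremum is
attained by a measurable selector, and that the tower property glues the steps together.

What travels backwards is regularity: `IsRegular`, that is, Hölder continuity on the graph with one
fixed exponent `α`, and growth of order `p`. Both one-step operations preserve it. For the infimum,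
moving the history moves a measure by a `W1` distance proportional to the displacement, and the
integral of an `α`-Hölder function then changes by at most a multiple of the `α`-th power of that
distance (`integral_le_of_W1_le`); growth follows from the moment bounds. For the supremum, the
Lipschitz property of `A t` moves the action instead. Together these give `isRegular_valueFn`.

Regularity makes the one-step integral jointly continuous in state, action and measure for `τ_p`
(`IsRegular.continuous_integral`). The optimizers then form a nonempty compact-valued
correspondence, and upper hemicontinuity makes its inverse images of closed sets closed. A
measurable selector is obtained by successively minimizing a countable separating family of
continuous functions (`exists_measurable_selector`, `exists_measurable_minimizer`).

For verification, consider the expectation of `Ψ_t` along a control. Under kernels that are worst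
for that control it does not increase with `t`, so the control earns at most `Ψ_0`
(`expectedObjective_composeKernel_le`). For the composed optimal control it does not decrease under
any admissible kernels, so at least `Ψ_0` is guaranteed (`value_le_expectedObjective`). The two
bounds give all the equalities. -/

/-! ### Measurable selection from compact-valued correspondences -/

/-- The points of `F x` at which `g` is minimal. -/
def argminOn {X Y : Type*} (g : Y → ℝ) (F : X → Set Y) (x : X) : Set Y :=
  {y | y ∈ F x ∧ ∀ y' ∈ F x, g y ≤ g y'}

theorem argminOn_subset {X Y : Type*} (g : Y → ℝ) (F : X → Set Y) (x : X) :
    argminOn g F x ⊆ F x := fun _ hy => hy.1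

theorem argminOn_nonempty {X Y : Type*} [TopologicalSpace Y] {g : Y → ℝ} (hg : Continuous g)
    {F : X → Set Y} {x : X} (hne : (F x).Nonempty) (hc : IsCompact (F x)) :
    (argminOn g F x).Nonempty := by
  obtain ⟨y, hy, hmin⟩ := hc.exists_isMinOn hne hg.continuousOn
  exact ⟨y, hy, fun y' hy' => hmin hy'⟩

theorem isCompact_argminOn {X Y : Type*} [TopologicalSpace Y] {g : Y → ℝ} (hg : Continuous g)
    {F : X → Set Y} {x : X} (hc : IsCompact (F x)) :
    IsCompact (argminOn g F x) := by
  have : argminOn g F x = F x ∩ ⋂ y' ∈ F x, {y | g y ≤ g y'} := by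
    ext y; simp [argminOn]
  rw [this]
  exact hc.inter_right (isClosed_biInter fun y' _ => isClosed_le hg continuous_const)

/-- A minimizer over `F x` lies in `C` exactly when the minimum over the compact set `F x ∩ C` is no
larger than that over `F x`. Comparing both with rational levels only turns this into countably many
conditions on sublevel sets, which are closed. -/
theorem measurableSet_argminOn_inter {X Y : Type*} [MeasurableSpace X] [TopologicalSpace Y]
    {g : Y → ℝ} (hg : Continuous g) {F : X → Set Y} (hc : ∀ x, IsCompact (F x))
    (hm : ∀ C, IsClosed C → MeasurableSet {x | (F x ∩ C).Nonempty}) {C : Set Y}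
    (hC : IsClosed C) : MeasurableSet {x | (argminOn g F x ∩ C).Nonempty} := by
  have hq : ∀ q : ℚ, IsClosed {y | g y ≤ (q : ℝ)} := fun q => isClosed_le hg continuous_const
  have : {x | (argminOn g F x ∩ C).Nonempty} = {x | (F x ∩ C).Nonempty} ∩
      ⋂ q : ℚ, ({x | (F x ∩ {y | g y ≤ (q : ℝ)}).Nonempty}ᶜ ∪
        {x | (F x ∩ (C ∩ {y | g y ≤ (q : ℝ)})).Nonempty}) := by
    ext x
    simp only [Set.mem_inter_iff, Set.mem_iInter, Set.mem_union, Set.mem_compl_iff,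
      Set.mem_ofPred_eq]
    constructor
    · rintro ⟨y, ⟨hy, hmin⟩, hyC⟩
      refine ⟨⟨y, hy, hyC⟩, fun q => ?_⟩
      by_cases h : (F x ∩ {y | g y ≤ (q : ℝ)}).Nonempty
      · obtain ⟨y', hy', hq'⟩ := h
        exact Or.inr ⟨y, hy, hyC, (hmin y' hy').trans hq'⟩
      · exact Or.inl h
    · rintro ⟨hne, h⟩
      obtain ⟨y, hy, hmin⟩ := ((hc x).inter_right hC).exists_isMinOn hne hg.continuousOn
      refine ⟨y, ⟨hy.1, fun y' hy' => ?_⟩, hy.2⟩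
      by_contra! hlt
      obtain ⟨q, hq1, hq2⟩ := exists_rat_btwn hlt
      rcases h q with h | ⟨w, hwF, hwC, hwq⟩
      · exact h ⟨y', hy', hq1.le⟩
      · exact absurd (hmin ⟨hwF, hwC⟩) (not_le.2 (lt_of_le_of_lt hwq hq2))
  rw [this]
  exact (hm C hC).inter (MeasurableSet.iInter fun q =>
    (hm _ (hq q)).compl.union (hm _ (hC.inter (hq q))))

/-- Successive minimization of `g 0, g 1, …` over `F x`. -/
def iterArgmin {X Y : Type*} (g : ℕ → Y → ℝ) (F : X → Set Y) : ℕ → X → Set Y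
  | 0 => F
  | n + 1 => argminOn (g n) (iterArgmin g F n)

/-- A compact-valued correspondence with measurable inverse images of closed sets has a
measurable selector, if countably many continuous functions separate the points of its range. -/
theorem exists_measurable_selector {X Y : Type*} [MeasurableSpace X] [TopologicalSpace Y]
    {g : ℕ → Y → ℝ} (hg : ∀ n, Continuous (g n))
    (hsep : ∀ y y', (∀ n, g n y = g n y') → y = y') {F : X → Set Y}
    (hne : ∀ x, (F x).Nonempty) (hc : ∀ x, IsCompact (F x))
    (hm : ∀ C, IsClosed C → MeasurableSet {x | (F x ∩ C).Nonempty}) :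
    ∃ f : X → Y, (∀ x, f x ∈ F x) ∧ ∀ C, IsClosed C → MeasurableSet (f ⁻¹' C) := by
  -- `Y` injects continuously into a countable product of lines. Being Hausdorff, it has closed
  -- compact sets, so Cantor's intersection theorem applies to the nested argmin sets.
  have hT2 : T2Space Y := by
    refine T2Space.of_injective_continuous (f := fun y n => g n y) (fun y y' h => ?_)
      (continuous_pi hg)
    exact hsep y y' fun n => congrFun h n
  have key : ∀ n, (∀ x, (iterArgmin g F n x).Nonempty) ∧ (∀ x, IsCompact (iterArgmin g F n x)) ∧
      ∀ C, IsClosed C → MeasurableSet {x | (iterArgmin g F n x ∩ C).Nonempty} := by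
    intro n
    induction n with
    | zero => exact ⟨hne, hc, hm⟩
    | succ n ih =>
      exact ⟨fun x => argminOn_nonempty (hg n) (ih.1 x) (ih.2.1 x),
        fun x => isCompact_argminOn (hg n) (ih.2.1 x),
        fun C hC => measurableSet_argminOn_inter (hg n) ih.2.1 ih.2.2 hC⟩
  have hinter : ∀ x (C : Set Y), IsClosed C → (∀ n, (iterArgmin g F n x ∩ C).Nonempty) →
      (⋂ n, iterArgmin g F n x ∩ C).Nonempty := fun x C hC h =>
    IsCompact.nonempty_iInter_of_sequence_nonempty_isCompact_isClosed _
      (fun n => Set.inter_subset_inter_left _ (argminOn_subset _ _ _)) h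
      (((key 0).2.1 x).inter_right hC) (fun n => (((key n).2.1 x).inter_right hC).isClosed)
  have hex : ∀ x, ∃ y, ∀ n, y ∈ iterArgmin g F n x := fun x => by
    obtain ⟨y, hy⟩ := hinter x Set.univ isClosed_univ (fun n => by simpa using (key n).1 x)
    exact ⟨y, fun n => (Set.mem_iInter.1 hy n).1⟩
  choose f hf using hex
  -- Two points surviving all minimizations have equal values under every `g n`, so they coincide.
  have huniq : ∀ x y, (∀ n, y ∈ iterArgmin g F n x) → y = f x := fun x y hy =>
    hsep _ _ fun n => le_antisymm ((hy (n + 1)).2 _ (hf x n)) ((hf x (n + 1)).2 _ (hy n))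
  refine ⟨f, fun x => hf x 0, fun C hC => ?_⟩
  have : f ⁻¹' C = ⋂ n, {x | (iterArgmin g F n x ∩ C).Nonempty} := by
    ext x
    simp only [Set.mem_preimage, Set.mem_iInter, Set.mem_ofPred_eq]
    refine ⟨fun h n => ⟨f x, hf x n, h⟩, fun h => ?_⟩
    obtain ⟨y, hy⟩ := hinter x C hC h
    rw [Set.mem_iInter] at hy
    rw [← huniq x y fun n => (hy n).1]
    exact (hy 0).2
  rw [this]
  exact MeasurableSet.iInter fun n => (key n).2.2 C hC

/-- For an upper hemicontinuous compact-valued correspondence `F` and a continuous function `h` on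
its graph, minimizers of `h x` over `F x` can be chosen measurably in `x`. -/
theorem exists_measurable_minimizer {X Y : Type*} [TopologicalSpace X] [MeasurableSpace X]
    [OpensMeasurableSpace X] [TopologicalSpace Y] {g : ℕ → Y → ℝ} (hg : ∀ n, Continuous (g n))
    (hsep : ∀ y y', (∀ n, g n y = g n y') → y = y') {F : X → Set Y}
    (hne : ∀ x, (F x).Nonempty) (hc : ∀ x, IsCompact (F x)) (hF : UpperHemicontinuous F)
    {h : X → Y → ℝ} {v : X → ℝ} (hv : Continuous v)
    (hh : ContinuousOn (fun z : X × Y => h z.1 z.2) {z | z.2 ∈ F z.1})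
    (hle : ∀ x, ∀ b, (∀ y ∈ F x, b ≤ h x y) → b ≤ v x) :
    ∃ f : X → Y, (∀ x, f x ∈ F x ∧ h x (f x) ≤ v x) ∧
      ∀ C, IsClosed C → MeasurableSet (f ⁻¹' C) := by
  have hhx : ∀ x, ContinuousOn (h x) (F x) := fun x =>
    hh.comp (f := fun y => (x, y)) (by fun_prop) (fun y hy => hy)
  have hclosed : ∀ C : Set Y, IsClosed C →
      IsClosed {x | ({y | y ∈ F x ∧ h x y ≤ v x} ∩ C).Nonempty} := by
    intro C hC
    rw [← isOpen_compl_iff, isOpen_iff_mem_nhds]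
    intro x hx
    -- Since `h` is continuous only on the graph of `F`, the condition "outside `C`, or above the
    -- level `v`" is open only relative to the graph. An open set of the whole product with the same
    -- trace is needed for the tube lemma.
    have hopen : ∃ O : Set (X × Y), IsOpen O ∧ ∀ z : X × Y, z.2 ∈ F z.1 →
        (z ∈ O ↔ (z.2 ∈ C → v z.1 < h z.1 z.2)) := by
      have h1 : ContinuousOn (fun z : X × Y => h z.1 z.2 - v z.1) {z | z.2 ∈ F z.1} :=
        hh.sub (hv.comp continuous_fst).continuousOn
      obtain ⟨O, hO, hO'⟩ := continuousOn_iff'.1 h1 (Set.Ioi 0) isOpen_Ioi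
      refine ⟨O ∪ Prod.snd ⁻¹' Cᶜ, hO.union (hC.isOpen_compl.preimage continuous_snd),
        fun z hz => ?_⟩
      have := Set.ext_iff.1 hO' z
      simp only [Set.mem_inter_iff, Set.mem_preimage, Set.mem_Ioi, sub_pos, Set.mem_ofPred_eq, hz,
        and_true] at this
      simp only [Set.mem_union, Set.mem_preimage, Set.mem_compl_iff, ← this]
      tauto
    obtain ⟨O, hO, hOiff⟩ := hopen
    have hsub : ({x} : Set X) ×ˢ F x ⊆ O := by
      rintro ⟨x', y⟩ ⟨rfl, hy⟩
      refine (hOiff _ hy).2 fun hyC => ?_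
      by_contra! hcon
      exact hx ⟨y, ⟨hy, hcon⟩, hyC⟩
    obtain ⟨U, V, hU, hV, hxU, hFV, hUV⟩ :=
      generalized_tube_lemma isCompact_singleton (hc x) hO hsub
    -- Upper hemicontinuity keeps `F x'` inside the tube for `x'` near `x`, so no point of `F x' ∩
    -- C` reaches the level `v x'`.
    have h2 := upperHemicontinuousAt_iff.1 (hF x) V (hV.mem_nhdsSet.2 hFV)
    filter_upwards [h2, hU.mem_nhds (hxU rfl)] with x' hx' hx'U
    rintro ⟨y, ⟨hy, hyv⟩, hyC⟩
    have hyV : y ∈ V := subset_of_mem_nhdsSet hx' hy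
    exact absurd ((hOiff (x', y) hy).1 (hUV ⟨hx'U, hyV⟩) hyC) (not_lt.2 hyv)
  have hne' : ∀ x, {y | y ∈ F x ∧ h x y ≤ v x}.Nonempty := fun x => by
    obtain ⟨y, hy, hmin⟩ := (hc x).exists_isMinOn (hne x) (hhx x)
    exact ⟨y, hy, hle x _ fun y' hy' => hmin hy'⟩
  have hc' : ∀ x, IsCompact {y | y ∈ F x ∧ h x y ≤ v x} := fun x => by
    obtain ⟨D, hD, hD'⟩ := continuousOn_iff_isClosed.1 (hhx x) (Set.Iic (v x)) isClosed_Iic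
    have : {y | y ∈ F x ∧ h x y ≤ v x} = F x ∩ D := by
      rw [Set.inter_comm (F x), ← hD']
      ext y; simp [and_comm]
    rw [this]
    exact (hc x).inter_right hD
  exact exists_measurable_selector hg hsep hne' hc' fun C hC => (hclosed C hC).measurableSet

section MomentTopology

/-! ### Continuity and measurability for `τ_q` -/

variable {d : ℕ} {Ωloc : Set (E d)}

theorem continuous_integral_polyGrowth {q : ℕ} {g : Ωloc → ℝ} (hg : g ∈ PolyGrowth Ωloc q) :
    Continuous fun μ : MomentMeasure Ωloc q => ∫ x, g x ∂(μ.1 : Measure Ωloc) :=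
  continuous_iff_continuousAt.2 fun _ => tendsto_momentMeasure_iff.1 tendsto_id g hg

theorem mem_polyGrowth_of_bounded {q : ℕ} {g : Ωloc → ℝ} (hg : Continuous g) {C : ℝ}
    (hC : ∀ x, |g x| ≤ C) : g ∈ PolyGrowth Ωloc q := by
  refine ⟨hg, |C|, fun x => (hC x).trans ((le_abs_self C).trans ?_)⟩
  exact le_mul_of_one_le_right (abs_nonneg C) (by simp)

theorem integrable_of_growth {q : ℕ} {μ : ProbabilityMeasure Ωloc} (hμ : HasMoment q μ)
    {g : Ωloc → ℝ} (hg : Continuous g) {C : ℝ} (hC : ∀ x, |g x| ≤ C * (1 + ‖(x : E d)‖ ^ q)) :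
    Integrable g (μ : Measure Ωloc) :=
  (((integrable_const (1 : ℝ)).add hμ).const_mul C).mono' hg.aestronglyMeasurable
    (Eventually.of_forall hC)

/-- Countably many functions which are continuous for `τ_q` separate the points of
`M_1^q(Ω_loc)`. -/
theorem exists_separating_momentMeasure (q : ℕ) : ∃ g : ℕ → MomentMeasure Ωloc q → ℝ,
    (∀ n, Continuous (g n)) ∧ ∀ μ ν, (∀ n, g n μ = g n ν) → μ = ν := by
  let ξ := TopologicalSpace.denseSeq (E d)
  let c : ℕ → Ωloc → ℝ := fun n x => Real.cos (inner ℝ (x : E d) (ξ n))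
  let s : ℕ → Ωloc → ℝ := fun n x => Real.sin (inner ℝ (x : E d) (ξ n))
  have hcm : ∀ n, c n ∈ PolyGrowth Ωloc q := fun n =>
    mem_polyGrowth_of_bounded (by fun_prop) fun x => Real.abs_cos_le_one _
  have hsm : ∀ n, s n ∈ PolyGrowth Ωloc q := fun n =>
    mem_polyGrowth_of_bounded (by fun_prop) fun x => Real.abs_sin_le_one _
  let G : ℕ ⊕ ℕ → MomentMeasure Ωloc q → ℝ :=
    Sum.elim (fun n μ => ∫ x, c n x ∂(μ.1 : Measure Ωloc))
      (fun n μ => ∫ x, s n x ∂(μ.1 : Measure Ωloc))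
  have hG : ∀ i, Continuous (G i) := by
    rintro (n | n)
    · exact continuous_integral_polyGrowth (hcm n)
    · exact continuous_integral_polyGrowth (hsm n)
  -- The chosen integrals are the real and imaginary parts of the characteristic function on a dense
  -- sequence. By continuity they determine the characteristic function, hence the measure.
  have hchar : ∀ (μ : MomentMeasure Ωloc q) n,
      charFun ((μ.1 : Measure Ωloc).map Subtype.val) (ξ n) =
        (G (Sum.inl n) μ : ℂ) + (G (Sum.inr n) μ : ℂ) * Complex.I := by
    intro μ n
    have hci : Integrable (c n) (μ.1 : Measure Ωloc) :=
      (integrable_const (1 : ℝ)).mono' (hcm n).1.aestronglyMeasurable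
        (Eventually.of_forall fun x => Real.abs_cos_le_one _)
    have hsi : Integrable (s n) (μ.1 : Measure Ωloc) :=
      (integrable_const (1 : ℝ)).mono' (hsm n).1.aestronglyMeasurable
        (Eventually.of_forall fun x => Real.abs_sin_le_one _)
    rw [charFun_apply, integral_map measurable_subtype_coe.aemeasurable
      (by fun_prop)]
    simp only [G, Sum.elim_inl, Sum.elim_inr]
    rw [← integral_complex_ofReal, ← integral_complex_ofReal, ← integral_mul_const,
      ← integral_add hci.ofReal (hsi.ofReal.mul_const _)]
    refine integral_congr_ae (Eventually.of_forall fun x => ?_)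
    simp only [c, s, Complex.exp_mul_I, Complex.ofReal_cos, Complex.ofReal_sin]
  refine ⟨fun n => G (Equiv.natSumNatEquivNat.symm n), fun n => hG _, fun μ ν h => ?_⟩
  have h' : ∀ i, G i μ = G i ν := fun i => by
    rw [← Equiv.natSumNatEquivNat.symm_apply_apply i]
    exact h _
  have hmap : (μ.1 : Measure Ωloc).map Subtype.val = (ν.1 : Measure Ωloc).map Subtype.val := by
    have : ∀ ρ : MomentMeasure Ωloc q, IsProbabilityMeasure
        ((ρ.1 : Measure Ωloc).map (Subtype.val : Ωloc → E d)) := fun ρ =>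
      Measure.isProbabilityMeasure_map measurable_subtype_coe.aemeasurable
    have h1 := this μ
    have h2 := this ν
    refine Measure.ext_of_charFun ?_
    refine (TopologicalSpace.denseRange_denseSeq (E d)).equalizer continuous_charFun
      continuous_charFun ?_
    funext n
    simp only [Function.comp_apply]
    rw [hchar, hchar, h', h']
  refine Subtype.ext (Subtype.ext ?_)
  refine Measure.ext fun B hB => ?_
  obtain ⟨B', hB', rfl⟩ := hB
  have := congrArg (fun ρ => ρ B') hmap
  simp only [Measure.map_apply measurable_subtype_coe hB'] at this
  exact this

/-- Closed sets form a generating π-system, and the mass of a closed set is the limit of the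
integrals of its thickened indicators, which are continuous with values in `[0, 1]`. -/
theorem measurable_probabilityMeasure_of_integral {X : Type*} [MeasurableSpace X]
    {κ : X → ProbabilityMeasure Ωloc}
    (h : ∀ g : Ωloc → ℝ, Continuous g → (∀ x, |g x| ≤ 1) →
      Measurable fun z => ∫ x, g x ∂(κ z : Measure Ωloc)) : Measurable κ := by
  have : ∀ z, IsProbabilityMeasure (κ z : Measure Ωloc) := fun z => inferInstance
  refine Measurable.subtype_mk (Measurable.measure_of_isPiSystem_of_isProbabilityMeasure
    (μ := fun z => (κ z : Measure Ωloc))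
    (by rw [← borel_eq_generateFrom_isClosed]; exact BorelSpace.measurable_eq) isPiSystem_isClosed ?_)
  intro C hC
  have hδ : ∀ n : ℕ, (0 : ℝ) < 1 / ((n : ℝ) + 1) := fun n => by positivity
  have hlim := fun z => tendsto_integral_thickenedIndicator_of_isClosed (κ z : Measure Ωloc) hC hδ
    tendsto_one_div_add_atTop_nhds_zero_nat
  have hmeas : Measurable fun z => (κ z : Measure Ωloc).real C := by
    refine measurable_of_tendsto_metrizable (fun n => h _ ?_ fun x => ?_)
      (tendsto_pi_nhds.2 hlim)
    · fun_prop
    · simpa using thickenedIndicator_le_one (hδ n) C x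
  simpa [Measure.real] using hmeas.ennreal_ofReal

end MomentTopology


/-! ### Histories, actions and the graph of the control correspondences -/

section Graph

variable {d : ℕ} {Ωloc : Set (E d)} {m : ℕ → ℕ}

@[simp] theorem extHist_castSucc {t : ℕ} (ω : Hist Ωloc t) (x : Ωloc) (i : Fin t) :
    extHist ω x i.castSucc = ω i := Fin.snoc_castSucc (α := fun _ => Ωloc) _ _ _

@[simp] theorem extHist_last {t : ℕ} (ω : Hist Ωloc t) (x : Ωloc) :
    extHist ω x (Fin.last t) = x := Fin.snoc_last (α := fun _ => Ωloc) _ _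

@[simp] theorem extActs_castSucc {t : ℕ} (a : Acts m t) (x : E (m t)) (i : Fin t) :
    extActs a x i.castSucc = a i :=
  Fin.snoc_castSucc (α := fun i : Fin (t + 1) => E (m i)) _ _ _

@[simp] theorem extActs_last {t : ℕ} (a : Acts m t) (x : E (m t)) :
    extActs a x (Fin.last t) = x := Fin.snoc_last (α := fun i : Fin (t + 1) => E (m i)) _ _

theorem pre_extHist {t : ℕ} (ω : Hist Ωloc t) (x : Ωloc) (k : ℕ) (hk : k ≤ t) (hk' : k ≤ t + 1) :
    pre (extHist ω x) k hk' = pre ω k hk := by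
  funext j
  exact extHist_castSucc ω x (Fin.castLE hk j)

@[simp] theorem pre_self {t : ℕ} (ω : Hist Ωloc t) (h : t ≤ t) : pre ω t h = ω := rfl

variable {A : (t : ℕ) → Hist Ωloc t → Set (E (m t))}

theorem extHist_mem_graph {t : ℕ} {ω : Hist Ωloc t} {a : Acts m (t + 1)} {x : Ωloc} :
    (extHist ω x, a) ∈ graph A (t + 1) (t + 1) (Nat.le_succ _) ↔
      (ω, a) ∈ graph A t (t + 1) le_rfl :=
  forall_congr' fun i => by
    rw [pre_extHist ω x i (Nat.lt_succ_iff.1 i.isLt)]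

theorem extActs_mem_graph {t : ℕ} {ω : Hist Ωloc t} {a : Acts m t} {x : E (m t)} :
    (ω, extActs a x) ∈ graph A t (t + 1) le_rfl ↔
      (ω, a) ∈ graph A t t (Nat.le_succ t) ∧ x ∈ A t ω := by
  refine Fin.forall_fin_succ'.trans (and_congr (forall_congr' fun i => ?_) ?_)
  · simp
  · simp

theorem continuous_extHist {t : ℕ} :
    Continuous fun z : Hist Ωloc t × Ωloc => extHist z.1 z.2 := by
  refine continuous_pi fun i => ?_
  refine Fin.lastCases ?_ (fun i => ?_) i
  · simpa using continuous_snd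
  · simp only [extHist_castSucc]; fun_prop

theorem continuous_extActs {t : ℕ} :
    Continuous fun z : Acts m t × E (m t) => extActs z.1 z.2 := by
  refine continuous_pi fun i => ?_
  refine Fin.lastCases ?_ (fun i => ?_) i
  · simpa using continuous_snd
  · simp only [extActs_castSucc]; exact (continuous_apply i).comp continuous_fst

end Graph

/-! ### Powers -/

/-- An affine majorant of the power function, used in place of Jensen's inequality: if `r` has mean
at most `s`, integrating it bounds the mean of `r ^ α` by `2 * s ^ α`. For `r > s`, write `r ^ α = r
^ (α - 1) * r` and use that the exponent `α - 1` is nonpositive. -/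
theorem rpow_le_rpow_add_mul {α r s : ℝ} (hα : 0 ≤ α) (hα1 : α ≤ 1) (hr : 0 ≤ r) (hs : 0 < s) :
    r ^ α ≤ s ^ α + s ^ (α - 1) * r := by
  rcases le_or_gt r s with h | h
  · have := Real.rpow_le_rpow hr h hα
    have : 0 ≤ s ^ (α - 1) * r := by positivity
    linarith
  · have hr' : 0 < r := hs.trans h
    have h1 : r ^ α = r ^ (α - 1) * r := by
      rw [← Real.rpow_add_one hr'.ne']; ring_nf
    have h2 : r ^ (α - 1) ≤ s ^ (α - 1) :=
      Real.rpow_le_rpow_of_nonpos hs h.le (by linarith)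
    rw [h1]
    have := mul_le_mul_of_nonneg_right h2 hr
    have : 0 ≤ s ^ α := by positivity
    linarith

theorem mul_sum_rpow_le {ι : Type*} (s : Finset ι) {x : ι → ℝ} (hx : ∀ i, 0 ≤ x i) {L α : ℝ}
    (hL : 0 ≤ L) (hα : 0 < α) (hα1 : α ≤ 1) :
    (L * ∑ i ∈ s, x i) ^ α ≤ L ^ α * ∑ i ∈ s, x i ^ α := by
  rw [Real.mul_rpow hL (Finset.sum_nonneg fun i _ => hx i)]
  refine mul_le_mul_of_nonneg_left ?_ (by positivity)
  lift x to ι → NNReal using hx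
  have := Finset.le_sum_of_subadditive (fun y : NNReal => y ^ α)
    (NNReal.zero_rpow hα.ne').le (fun a b => NNReal.rpow_add_le_add_rpow a b hα.le hα1) s x
  beta_reduce
  exact_mod_cast this

/-! ### Comparison of integrals through the Wasserstein distance -/

section Wasserstein

variable {d : ℕ} {Ωloc : Set (E d)}

/-- Integrate the pointwise bound against a nearly optimal coupling. Working with a cost bound `s >
w` and letting `s` decrease to `w` avoids needing an optimal coupling, and keeps `s` positive when
`w = 0`. The factor `2` comes from `rpow_le_rpow_add_mul`. -/
theorem integral_le_of_W1_le {μ ν : ProbabilityMeasure Ωloc} {f g : Ωloc → ℝ}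
    (hf : Integrable f (μ : Measure Ωloc)) (hg : Integrable g (ν : Measure Ωloc)) {K L α w : ℝ}
    (hL : 0 ≤ L) (hα : 0 < α) (hα1 : α ≤ 1) (hw : 0 ≤ w)
    (h : ∀ x y, g y ≤ f x + (K + L * ‖(x : E d) - y‖ ^ α)) (hW : W1 μ ν ≤ ENNReal.ofReal w) :
    ∫ y, g y ∂(ν : Measure Ωloc) ≤ ∫ x, f x ∂(μ : Measure Ωloc) + (K + L * (2 * w ^ α)) := by
  have key : ∀ s, w < s →
      ∫ y, g y ∂(ν : Measure Ωloc) ≤ ∫ x, f x ∂(μ : Measure Ωloc) + (K + L * (2 * s ^ α)) := by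
    intro s hs
    have hs0 : 0 < s := hw.trans_lt hs
    have hlt : W1 μ ν < ENNReal.ofReal s :=
      hW.trans_lt ((ENNReal.ofReal_lt_ofReal_iff hs0).2 hs)
    simp only [W1, iInf_lt_iff] at hlt
    obtain ⟨π, ⟨hπ1, hπ2⟩, hπ⟩ := hlt
    have hprob : IsProbabilityMeasure π := by
      constructor
      have := congrArg (fun ρ => ρ Set.univ) hπ1
      simpa [Measure.map_apply measurable_fst MeasurableSet.univ] using this
    have hcont : Continuous fun z : Ωloc × Ωloc => ‖(z.1 : E d) - z.2‖ := by fun_prop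
    have hint : Integrable (fun z : Ωloc × Ωloc => ‖(z.1 : E d) - z.2‖) π := by
      refine ⟨hcont.aestronglyMeasurable, ?_⟩
      rw [hasFiniteIntegral_iff_ofReal (Eventually.of_forall fun z => norm_nonneg _)]
      exact hπ.trans ENNReal.ofReal_lt_top
    have hcost : ∫ z : Ωloc × Ωloc, ‖(z.1 : E d) - z.2‖ ∂π ≤ s := by
      rw [integral_eq_lintegral_of_nonneg_ae (Eventually.of_forall fun z => norm_nonneg _)
        hcont.aestronglyMeasurable]
      exact ENNReal.toReal_le_of_le_ofReal hs0.le hπ.le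
    rw [← hπ1] at hf
    rw [← hπ2] at hg
    rw [← hπ1, ← hπ2, integral_map measurable_fst.aemeasurable hf.aestronglyMeasurable,
      integral_map measurable_snd.aemeasurable hg.aestronglyMeasurable]
    have hf' : Integrable (fun z : Ωloc × Ωloc => f z.1) π := hf.comp_measurable measurable_fst
    have hg' : Integrable (fun z : Ωloc × Ωloc => g z.2) π := hg.comp_measurable measurable_snd
    have hb' : Integrable (fun z : Ωloc × Ωloc =>
        L * (s ^ α + s ^ (α - 1) * ‖(z.1 : E d) - z.2‖)) π :=
      ((integrable_const _).add (hint.const_mul _)).const_mul _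
    have hb : Integrable (fun z : Ωloc × Ωloc =>
        K + L * (s ^ α + s ^ (α - 1) * ‖(z.1 : E d) - z.2‖)) π :=
      (integrable_const _).add hb'
    calc ∫ z, g z.2 ∂π ≤ ∫ z : Ωloc × Ωloc,
          (f z.1 + (K + L * (s ^ α + s ^ (α - 1) * ‖(z.1 : E d) - z.2‖))) ∂π := by
          refine integral_mono hg' (hf'.add hb) fun z => (h z.1 z.2).trans ?_
          gcongr
          exact rpow_le_rpow_add_mul hα.le hα1 (norm_nonneg _) hs0
      _ = ∫ z, f z.1 ∂π + (K + L * (s ^ α + s ^ (α - 1) *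
          ∫ z : Ωloc × Ωloc, ‖(z.1 : E d) - z.2‖ ∂π)) := by
          rw [integral_add hf' hb, integral_add (integrable_const _) hb', integral_const_mul,
            integral_add (integrable_const _) (hint.const_mul _), integral_const_mul]
          simp
      _ ≤ _ := by
          have h1 : s ^ (α - 1) * s = s ^ α := by
            rw [← Real.rpow_add_one hs0.ne']; ring_nf
          have h2 : s ^ (α - 1) * ∫ z : Ωloc × Ωloc, ‖(z.1 : E d) - z.2‖ ∂π ≤ s ^ α :=
            (mul_le_mul_of_nonneg_left hcost (by positivity)).trans h1.le
          gcongr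
          linarith
  refine ge_of_tendsto (x := 𝓝[>] w) ?_ (eventually_nhdsWithin_of_forall key)
  have : Tendsto (fun s : ℝ => s ^ α) (𝓝[>] w) (𝓝 (w ^ α)) :=
    (Real.continuousAt_rpow_const w α (Or.inr hα.le)).tendsto.mono_left nhdsWithin_le_nhds
  exact (((this.const_mul 2).const_mul L).const_add K).const_add _

end Wasserstein

/-! ### Hölder continuity and growth in the backward recursion -/

section Regularity

variable {d : ℕ} {Ωloc : Set (E d)} {m : ℕ → ℕ}

/-- The sum of the `α`-th powers of the distances between the entries of two points. -/
def holderDist (α : ℝ) {t s : ℕ} (z z' : Hist Ωloc t × Acts m s) : ℝ :=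
  ∑ i, ‖(z.1 i : E d) - z'.1 i‖ ^ α + ∑ i, ‖z.2 i - z'.2 i‖ ^ α

theorem holderDist_comm (α : ℝ) {t s : ℕ} (z z' : Hist Ωloc t × Acts m s) :
    holderDist α z z' = holderDist α z' z := by
  simp only [holderDist, norm_sub_rev]

theorem holderDist_extHist (α : ℝ) {t s : ℕ} (ω ω' : Hist Ωloc t) (x x' : Ωloc)
    (a a' : Acts m s) : holderDist α (extHist ω x, a) (extHist ω' x', a') =
      holderDist α (ω, a) (ω', a') + ‖(x : E d) - x'‖ ^ α := by
  simp only [holderDist, Fin.sum_univ_castSucc, extHist_castSucc, extHist_last]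
  ring

theorem holderDist_extActs (α : ℝ) {t : ℕ} (ω ω' : Hist Ωloc t) (a a' : Acts m t)
    (x x' : E (m t)) : holderDist α (ω, extActs a x) (ω', extActs a' x') =
      holderDist α (ω, a) (ω', a') + ‖x - x'‖ ^ α := by
  simp only [holderDist, Fin.sum_univ_castSucc, extActs_castSucc, extActs_last]
  exact (add_assoc _ _ _).symm

theorem mul_sum_rpow_le_holderDist {L α : ℝ} (hL : 0 ≤ L) (hα : 0 < α) (hα1 : α ≤ 1) {t s : ℕ}
    (z z' : Hist Ωloc t × Acts m s) :
    (L * ∑ i, ‖(z.1 i : E d) - z'.1 i‖) ^ α ≤ L ^ α * holderDist α z z' := by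
  refine (mul_sum_rpow_le _ (fun i => norm_nonneg _) hL hα hα1).trans ?_
  refine mul_le_mul_of_nonneg_left ?_ (by positivity)
  exact le_add_of_nonneg_right (by positivity)

theorem tendsto_holderDist {α : ℝ} (hα : 0 < α) {t s : ℕ} (z : Hist Ωloc t × Acts m s) :
    Tendsto (fun z' => holderDist α z' z) (𝓝 z) (𝓝 0) := by
  have h : Continuous fun z' : Hist Ωloc t × Acts m s => holderDist α z' z := by
    refine Continuous.add ?_ ?_
    · exact continuous_finsetSum _ fun i _ =>
        Continuous.rpow_const (by fun_prop) fun _ => Or.inr hα.le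
    · exact continuous_finsetSum _ fun i _ => Continuous.rpow_const
        ((((continuous_apply i).comp continuous_snd).sub continuous_const).norm)
          fun _ => Or.inr hα.le
  have := h.tendsto z
  simpa [holderDist, Real.zero_rpow hα.ne'] using this

variable (A : (t : ℕ) → Hist Ωloc t → Set (E (m t)))

/-- `α`-Hölder continuity and growth of order `p` on `Ω^t × 𝒜^s`. -/
structure IsRegular (p : ℕ) (α : ℝ) {t s : ℕ} (h : s ≤ t + 1)
    (f : Hist Ωloc t → Acts m s → ℝ) : Prop where
  holder : ∃ L : ℝ, 0 ≤ L ∧ ∀ z ∈ graph A t s h, ∀ z' ∈ graph A t s h,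
    |f z.1 z.2 - f z'.1 z'.2| ≤ L * holderDist α z z'
  growth : ∃ C : ℝ, 0 ≤ C ∧ ∀ z ∈ graph A t s h,
    |f z.1 z.2| ≤ C * (1 + ∑ i, ‖(z.1 i : E d)‖ ^ p)

variable {A}

/-- Comparisons of infima or suprema naturally give one-sided bounds; the symmetry of `holderDist`
supplies the other side. -/
theorem abs_sub_le_holderDist {α L : ℝ} {t s : ℕ} {S : Set (Hist Ωloc t × Acts m s)}
    {f : Hist Ωloc t → Acts m s → ℝ}
    (h : ∀ z ∈ S, ∀ z' ∈ S, f z'.1 z'.2 ≤ f z.1 z.2 + L * holderDist α z z') :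
    ∀ z ∈ S, ∀ z' ∈ S, |f z.1 z.2 - f z'.1 z'.2| ≤ L * holderDist α z z' := by
  intro z hz z' hz'
  have h1 := h z hz z' hz'
  have h2 := h z' hz' z hz
  rw [holderDist_comm] at h2
  exact abs_sub_le_iff.2 ⟨by linarith, by linarith⟩

namespace IsRegular

variable {p : ℕ} {α : ℝ}

theorem continuousOn (hα : 0 < α) {t s : ℕ} {h : s ≤ t + 1} {f : Hist Ωloc t → Acts m s → ℝ}
    (hf : IsRegular A p α h f) :
    ContinuousOn (fun z : Hist Ωloc t × Acts m s => f z.1 z.2) (graph A t s h) := by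
  obtain ⟨L, hL, hf⟩ := hf.holder
  intro z hz
  refine tendsto_iff_norm_sub_tendsto_zero.2 ?_
  refine squeeze_zero' (Eventually.of_forall fun _ => norm_nonneg _)
    (eventually_nhdsWithin_of_forall fun z' hz' => hf z' hz' z hz) ?_
  simpa using ((tendsto_holderDist hα z).mono_left nhdsWithin_le_nhds).const_mul L

/-- With history and actions frozen, their contribution to the growth is absorbed in the constant,
so the one-step integrand is a test function for `τ_p`. -/
theorem mem_polyGrowth (hα : 0 < α) {t : ℕ} {f : Hist Ωloc (t + 1) → Acts m (t + 1) → ℝ}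
    (hf : IsRegular A p α (Nat.le_succ _) f) {ω : Hist Ωloc t} {a : Acts m (t + 1)}
    (hz : (ω, a) ∈ graph A t (t + 1) le_rfl) :
    (fun x => f (extHist ω x) a) ∈ PolyGrowth Ωloc p := by
  refine ⟨?_, ?_⟩
  · rw [← continuousOn_univ]
    refine (hf.continuousOn hα).comp (f := fun x => (extHist ω x, a)) ?_
      fun x _ => extHist_mem_graph.2 hz
    exact ((continuous_extHist.comp (Continuous.prodMk_right ω)).prodMk
      continuous_const).continuousOn
  · obtain ⟨C, hC, hg⟩ := hf.growth
    refine ⟨C * (1 + ∑ i, ‖(ω i : E d)‖ ^ p), fun x => ?_⟩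
    refine (hg _ (extHist_mem_graph.2 hz)).trans ?_
    rw [mul_assoc]
    refine mul_le_mul_of_nonneg_left ?_ hC
    simp only [Fin.sum_univ_castSucc, extHist_castSucc, extHist_last]
    have h1 : 0 ≤ ∑ i, ‖(ω i : E d)‖ ^ p := by positivity
    have h2 : 0 ≤ ‖(x : E d)‖ ^ p := by positivity
    nlinarith

theorem integrable (hα : 0 < α) {t : ℕ} {f : Hist Ωloc (t + 1) → Acts m (t + 1) → ℝ}
    (hf : IsRegular A p α (Nat.le_succ _) f) {ω : Hist Ωloc t} {a : Acts m (t + 1)}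
    (hz : (ω, a) ∈ graph A t (t + 1) le_rfl) {μ : ProbabilityMeasure Ωloc} (hμ : HasMoment p μ) :
    Integrable (fun x => f (extHist ω x) a) (μ : Measure Ωloc) := by
  obtain ⟨hc, C, hC⟩ := hf.mem_polyGrowth hα hz
  exact integrable_of_growth hμ hc hC

/-- Growth of the one-step integrals. -/
theorem exists_abs_integral_le (hα : 0 < α) {t : ℕ} {f : Hist Ωloc (t + 1) → Acts m (t + 1) → ℝ}
    (hf : IsRegular A p α (Nat.le_succ _) f) {P : Hist Ωloc t → Set (ProbabilityMeasure Ωloc)}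
    (hmom : ∀ ω, ∀ μ ∈ P ω, HasMoment p μ) {Cp : ℝ} (hCp : 0 ≤ Cp)
    (hbd : ∀ ω : Hist Ωloc t, ∀ μ ∈ P ω,
      ∫ x, ‖(x : E d)‖ ^ p ∂(μ : Measure Ωloc) ≤ Cp * (1 + ∑ i, ‖(ω i : E d)‖ ^ p)) :
    ∃ C : ℝ, 0 ≤ C ∧ ∀ z ∈ graph A t (t + 1) le_rfl, ∀ μ ∈ P z.1,
      |∫ x, f (extHist z.1 x) z.2 ∂(μ : Measure Ωloc)| ≤ C * (1 + ∑ i, ‖(z.1 i : E d)‖ ^ p) := by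
  obtain ⟨C, hC, hg⟩ := hf.growth
  refine ⟨C * (1 + Cp), by positivity, fun z hz μ hμ => ?_⟩
  have hm := hmom _ μ hμ
  set S := ∑ i, ‖(z.1 i : E d)‖ ^ p with hS
  calc |∫ x, f (extHist z.1 x) z.2 ∂(μ : Measure Ωloc)|
      ≤ ∫ x, |f (extHist z.1 x) z.2| ∂(μ : Measure Ωloc) := abs_integral_le_integral_abs
    _ ≤ ∫ x, C * ((1 + S) + ‖(x : E d)‖ ^ p) ∂(μ : Measure Ωloc) := by
        refine integral_mono (hf.integrable hα hz hm).abs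
          (((integrable_const _).add hm).const_mul C) fun x => ?_
        refine (hg _ (extHist_mem_graph.2 hz)).trans_eq ?_
        simp only [Fin.sum_univ_castSucc, extHist_castSucc, extHist_last, hS]
        ring
    _ = C * ((1 + S) + ∫ x, ‖(x : E d)‖ ^ p ∂(μ : Measure Ωloc)) := by
        rw [integral_const_mul, integral_add (integrable_const _) hm]
        simp
    _ ≤ C * ((1 + S) + Cp * (1 + S)) := by
        gcongr
        exact hbd _ μ hμ
    _ = _ := by ring

theorem bddBelow_integral (hα : 0 < α) {t : ℕ} {f : Hist Ωloc (t + 1) → Acts m (t + 1) → ℝ}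
    (hf : IsRegular A p α (Nat.le_succ _) f) {P : Hist Ωloc t → Set (ProbabilityMeasure Ωloc)}
    (hmom : ∀ ω, ∀ μ ∈ P ω, HasMoment p μ) {Cp : ℝ} (hCp : 0 ≤ Cp)
    (hbd : ∀ ω : Hist Ωloc t, ∀ μ ∈ P ω,
      ∫ x, ‖(x : E d)‖ ^ p ∂(μ : Measure Ωloc) ≤ Cp * (1 + ∑ i, ‖(ω i : E d)‖ ^ p))
    {z : Hist Ωloc t × Acts m (t + 1)} (hz : z ∈ graph A t (t + 1) le_rfl) :
    BddBelow (Set.range fun μ : P z.1 =>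
      ∫ x, f (extHist z.1 x) z.2 ∂((μ : ProbabilityMeasure Ωloc) : Measure Ωloc)) := by
  obtain ⟨C, hC, h⟩ := hf.exists_abs_integral_le hα hmom hCp hbd
  refine ⟨-(C * (1 + ∑ i, ‖(z.1 i : E d)‖ ^ p)), ?_⟩
  rintro _ ⟨μ, rfl⟩
  exact (abs_le.1 (h z hz μ μ.2)).1

/-- The worst case expectation inherits regularity. -/
theorem worstCase (hα : 0 < α) (hα1 : α ≤ 1) {P : (t : ℕ) → Hist Ωloc t → Set (ProbabilityMeasure Ωloc)}
    {t : ℕ} {f : Hist Ωloc (t + 1) → Acts m (t + 1) → ℝ}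
    (hf : IsRegular A p α (Nat.le_succ _) f)
    (hne : ∀ ω, (P t ω).Nonempty) (hmom : ∀ ω, ∀ μ ∈ P t ω, HasMoment p μ) {Cp : ℝ} (hCp : 0 ≤ Cp)
    (hbd : ∀ ω : Hist Ωloc t, ∀ μ ∈ P t ω,
      ∫ x, ‖(x : E d)‖ ^ p ∂(μ : Measure Ωloc) ≤ Cp * (1 + ∑ i, ‖(ω i : E d)‖ ^ p))
    {Lp : ℝ} (hLp : 0 ≤ Lp) (hlip : ∀ ω ω' : Hist Ωloc t, ∀ μ ∈ P t ω, ∃ μ' ∈ P t ω',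
      W1 μ μ' ≤ ENNReal.ofReal (Lp * ∑ i, ‖(ω i : E d) - (ω' i : E d)‖)) :
    IsRegular A p α le_rfl (worstCase P f) := by
  have hbb := fun z hz => hf.bddBelow_integral hα hmom hCp hbd (z := z) hz
  have hne' : ∀ ω, Nonempty (P t ω) := fun ω => (hne ω).to_subtype
  constructor
  · obtain ⟨L, hL, hh⟩ := hf.holder
    -- `L` accounts for moving the history and actions inside the integrand, `2 * L * Lp ^ α` for
    -- moving the measure.
    refine ⟨L * (1 + 2 * Lp ^ α), by positivity, abs_sub_le_holderDist ?_⟩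
    intro z hz z' hz'
    rw [← sub_le_iff_le_add]
    refine le_ciInf fun ⟨μ, hμ⟩ => ?_
    rw [sub_le_iff_le_add]
    obtain ⟨μ', hμ', hW⟩ := hlip z.1 z'.1 μ hμ
    refine (ciInf_le (hbb z' hz') ⟨μ', hμ'⟩).trans ?_
    refine (integral_le_of_W1_le (hf.integrable hα hz (hmom _ μ hμ))
      (hf.integrable hα hz' (hmom _ μ' hμ')) (K := L * holderDist α z z') hL hα hα1
      (by positivity) (fun x y => ?_) hW).trans ?_
    · have := (abs_sub_le_iff.1 (hh (extHist z.1 x, z.2) (extHist_mem_graph.2 hz)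
        (extHist z'.1 y, z'.2) (extHist_mem_graph.2 hz'))).2
      rw [holderDist_extHist] at this
      linarith
    · have := mul_sum_rpow_le_holderDist hLp hα hα1 z z'
      rw [mul_assoc L, ← mul_add]
      gcongr
      linarith
  · obtain ⟨C, hC, h⟩ := hf.exists_abs_integral_le hα hmom hCp hbd
    refine ⟨C, hC, fun z hz => abs_le.2 ⟨?_, ?_⟩⟩
    · exact le_ciInf fun μ => (abs_le.1 (h z hz μ μ.2)).1
    · obtain ⟨μ, hμ⟩ := hne z.1
      exact (ciInf_le (hbb z hz) ⟨μ, hμ⟩).trans (abs_le.1 (h z hz μ hμ)).2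

theorem bddAbove_extActs {t : ℕ} {g : Hist Ωloc t → Acts m (t + 1) → ℝ}
    (hg : IsRegular A p α le_rfl g) {z : Hist Ωloc t × Acts m t}
    (hz : z ∈ graph A t t (Nat.le_succ t)) :
    BddAbove (Set.range fun x : A t z.1 => g z.1 (extActs z.2 x)) := by
  obtain ⟨C, hC, h⟩ := hg.growth
  refine ⟨C * (1 + ∑ i, ‖(z.1 i : E d)‖ ^ p), ?_⟩
  rintro _ ⟨x, rfl⟩
  exact (abs_le.1 (h (z.1, extActs z.2 x) (extActs_mem_graph.2 ⟨hz, x.2⟩))).2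

/-- Maximization over the last action preserves regularity. -/
theorem bestAction (hα : 0 < α) (hα1 : α ≤ 1) {t : ℕ} {g : Hist Ωloc t → Acts m (t + 1) → ℝ}
    (hg : IsRegular A p α le_rfl g) (hne : ∀ ω, (A t ω).Nonempty) {La : ℝ} (hLa : 0 ≤ La)
    (hlip : ∀ ω ω' : Hist Ωloc t, ∀ a ∈ A t ω, ∃ a' ∈ A t ω',
      ‖a - a'‖ ≤ La * ∑ i, ‖(ω i : E d) - (ω' i : E d)‖) :
    IsRegular A p α (Nat.le_succ t) (bestAction A g) := by
  have hne' : ∀ ω, Nonempty (A t ω) := fun ω => (hne ω).to_subtype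
  constructor
  · obtain ⟨L, hL, hh⟩ := hg.holder
    -- The extra `La ^ α` pays for replacing the last action by a nearby one admissible at the other
    -- history.
    refine ⟨L * (1 + La ^ α), by positivity, abs_sub_le_holderDist ?_⟩
    intro z hz z' hz'
    refine ciSup_le fun ⟨x', hx'⟩ => ?_
    obtain ⟨x, hx, hxx⟩ := hlip z'.1 z.1 x' hx'
    have h1 := le_ciSup (hg.bddAbove_extActs hz) ⟨x, hx⟩
    have h2 := (abs_sub_le_iff.1 (hh (z.1, extActs z.2 x) (extActs_mem_graph.2 ⟨hz, hx⟩)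
      (z'.1, extActs z'.2 x') (extActs_mem_graph.2 ⟨hz', hx'⟩))).2
    rw [holderDist_extActs] at h2
    have h3 := mul_sum_rpow_le_holderDist hLa hα hα1 z' z
    have h4 := Real.rpow_le_rpow (norm_nonneg _) hxx hα.le
    rw [norm_sub_rev] at h4
    rw [holderDist_comm] at h3
    have h5 : L * (holderDist α z z' + ‖x - x'‖ ^ α) ≤ L * (1 + La ^ α) * holderDist α z z' := by
      rw [mul_assoc]
      gcongr
      linarith
    have h6 : g z.1 (extActs z.2 x) ≤ RobustControl.bestAction A g z.1 z.2 := h1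
    simp only at h2
    linarith
  · obtain ⟨C, hC, h⟩ := hg.growth
    refine ⟨C, hC, fun z hz => abs_le.2 ⟨?_, ?_⟩⟩
    · obtain ⟨x, hx⟩ := hne z.1
      exact (abs_le.1 (h _ (extActs_mem_graph.2 ⟨hz, hx⟩))).1.trans
        (le_ciSup (hg.bddAbove_extActs hz) ⟨x, hx⟩)
    · exact ciSup_le fun x => (abs_le.1 (h _ (extActs_mem_graph.2 ⟨hz, x.2⟩))).2

end IsRegular

end Regularity


/-! ### The assumptions at an arbitrary time -/

section Assumptions

variable {d : ℕ} {Ωloc : Set (E d)} {m : ℕ → ℕ} {A : (t : ℕ) → Hist Ωloc t → Set (E (m t))}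
  {P : (t : ℕ) → Hist Ωloc t → Set (ProbabilityMeasure Ωloc)} {T p : ℕ}

/-- As `Ω^0` is a single point, hemicontinuity is automatic at time `0`, and the Lipschitz
conditions hold there with constant `0`. This lets time `0` be treated like all others. -/
theorem upperHemicontinuous_of_subsingleton {X Y : Type*} [TopologicalSpace X] [Subsingleton X]
    [TopologicalSpace Y] (F : X → Set Y) : UpperHemicontinuous F := fun x =>
  upperHemicontinuousAt_iff.2 fun V hV => Eventually.of_forall fun x' => by
    rwa [Subsingleton.elim x' x]

theorem upperHemicontinuous_comp {X X' Y : Type*} [TopologicalSpace X] [TopologicalSpace X']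
    [TopologicalSpace Y] {F : X → Set Y} (hF : UpperHemicontinuous F) {φ : X' → X}
    (hφ : Continuous φ) : UpperHemicontinuous fun x => F (φ x) := fun x =>
  upperHemicontinuousAt_iff.2 fun V hV =>
    (hφ.tendsto x).eventually (upperHemicontinuousAt_iff.1 (hF (φ x)) V hV)

namespace ControlAssumption

variable (hA : ControlAssumption A T)
include hA

theorem nonempty' {t : ℕ} (ht : t < T) (ω : Hist Ωloc t) : (A t ω).Nonempty := by
  rcases Nat.eq_zero_or_pos t with rfl | h
  exacts [hA.nonempty_zero ω, hA.nonempty t h ht ω]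

theorem compact' {t : ℕ} (ht : t < T) (ω : Hist Ωloc t) : IsCompact (A t ω) := by
  rcases Nat.eq_zero_or_pos t with rfl | h
  exacts [hA.compact_zero ω, hA.compact t h ht ω]

theorem upper' {t : ℕ} (ht : t < T) : UpperHemicontinuous (A t) := by
  rcases Nat.eq_zero_or_pos t with rfl | h
  exacts [upperHemicontinuous_of_subsingleton _, hA.upper t h ht]

theorem lipschitz' {t : ℕ} (ht : t < T) : ∃ L : ℝ, 0 ≤ L ∧ ∀ ω ω' : Hist Ωloc t,
    ∀ a ∈ A t ω, ∃ a' ∈ A t ω', ‖a - a'‖ ≤ L * ∑ i, ‖(ω i : E d) - (ω' i : E d)‖ := by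
  rcases Nat.eq_zero_or_pos t with rfl | h
  · exact ⟨0, le_rfl, fun ω ω' a ha => ⟨a, Subsingleton.elim ω ω' ▸ ha, by simp⟩⟩
  · exact hA.lipschitz t h ht

end ControlAssumption

theorem W1_self (μ : ProbabilityMeasure Ωloc) : W1 μ μ = 0 := by
  have hm : Measurable fun x : Ωloc => (x, x) := by fun_prop
  refine le_antisymm (iInf₂_le_of_le ((μ : Measure Ωloc).map fun x => (x, x)) ⟨?_, ?_⟩ ?_)
    zero_le
  · rw [Measure.map_map measurable_fst hm]; exact Measure.map_id
  · rw [Measure.map_map measurable_snd hm]; exact Measure.map_id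
  · rw [lintegral_map (by fun_prop) hm]; simp

namespace AmbiguityAssumption

variable (hP : AmbiguityAssumption P T p)
include hP

theorem moment' {t : ℕ} (ht : t < T) (ω : Hist Ωloc t) : ∀ μ ∈ P t ω, HasMoment p μ := by
  rcases Nat.eq_zero_or_pos t with rfl | h
  exacts [hP.moment_zero ω, hP.moment t h ht ω]

theorem nonempty' {t : ℕ} (ht : t < T) (ω : Hist Ωloc t) : (P t ω).Nonempty := by
  rcases Nat.eq_zero_or_pos t with rfl | h
  exacts [hP.nonempty_zero ω, hP.nonempty t h ht ω]

theorem compact' {t : ℕ} (ht : t < T) (ω : Hist Ωloc t) : IsCompact (inMoment p (P t ω)) := by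
  rcases Nat.eq_zero_or_pos t with rfl | h
  exacts [hP.compact_zero ω, hP.compact t h ht ω]

theorem upper' {t : ℕ} (ht : t < T) : UpperHemicontinuous fun ω => inMoment p (P t ω) := by
  rcases Nat.eq_zero_or_pos t with rfl | h
  exacts [upperHemicontinuous_of_subsingleton _, hP.upper t h ht]

theorem moment_bound' {t : ℕ} (ht : t < T) : ∃ C : ℝ, 0 ≤ C ∧ ∀ ω : Hist Ωloc t, ∀ μ ∈ P t ω,
    ∫ x, ‖(x : E d)‖ ^ p ∂(μ : Measure Ωloc) ≤ C * (1 + ∑ i, ‖(ω i : E d)‖ ^ p) := by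
  rcases Nat.eq_zero_or_pos t with rfl | h
  · obtain ⟨C, hC, hb⟩ := hP.moment_bound_zero
    exact ⟨C, zero_le_one.trans hC, fun ω μ hμ => by simpa using hb ω μ hμ⟩
  · obtain ⟨C, hC, hb⟩ := hP.moment_bound t h ht
    exact ⟨C, zero_le_one.trans hC, hb⟩

theorem lipschitz' {t : ℕ} (ht : t < T) : ∃ L : ℝ, 0 ≤ L ∧ ∀ ω ω' : Hist Ωloc t,
    ∀ μ ∈ P t ω, ∃ μ' ∈ P t ω',
      W1 μ μ' ≤ ENNReal.ofReal (L * ∑ i, ‖(ω i : E d) - (ω' i : E d)‖) := by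
  rcases Nat.eq_zero_or_pos t with rfl | h
  · exact ⟨0, le_rfl, fun ω ω' μ hμ => ⟨μ, Subsingleton.elim ω ω' ▸ hμ, by simp [W1_self]⟩⟩
  · exact hP.lipschitz t h ht

end AmbiguityAssumption

/-! ### Regularity of the value functions -/

theorem isRegular_objective {Ψ : Hist Ωloc T → Acts m T → ℝ} (hΨ : ObjectiveAssumption A T p Ψ) :
    ∃ α : ℝ, 0 < α ∧ α ≤ 1 ∧ IsRegular A p α (Nat.le_succ T) Ψ := by
  obtain ⟨L, α, hL, hα, hα1, h⟩ := hΨ.holder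
  obtain ⟨C, hC, hg⟩ := hΨ.growth
  refine ⟨α, hα, hα1, ⟨L, hL, fun z hz z' hz' => (h z hz z' hz').trans_eq ?_⟩,
    C, zero_le_one.trans hC, hg⟩
  rw [Finset.sum_add_distrib, holderDist]

theorem isRegular_J {Ψ : Hist Ωloc T → Acts m T → ℝ} (hP : AmbiguityAssumption P T p) {α : ℝ}
    (hα : 0 < α) (hα1 : α ≤ 1) {t : ℕ} (ht : t < T)
    (h : IsRegular A p α (Nat.le_succ _) (valueFn A P Ψ (t + 1) ht)) :
    IsRegular A p α le_rfl (J A P Ψ t ht) := by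
  obtain ⟨C, hC, hb⟩ := hP.moment_bound' ht
  obtain ⟨L, hL, hl⟩ := hP.lipschitz' ht
  exact h.worstCase hα hα1 (hP.nonempty' ht) (hP.moment' ht) hC hb hL hl

theorem isRegular_valueFn {Ψ : Hist Ωloc T → Acts m T → ℝ} (hA : ControlAssumption A T)
    (hP : AmbiguityAssumption P T p) {α : ℝ} (hα : 0 < α) (hα1 : α ≤ 1)
    (hΨ : IsRegular A p α (Nat.le_succ T) Ψ) {t : ℕ} (ht : t ≤ T) :
    IsRegular A p α (Nat.le_succ t) (valueFn A P Ψ t ht) := by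
  induction ht using Nat.decreasingInduction with
  | self => rwa [valueFn_last]
  | of_succ t ht ih =>
    rw [valueFn_step]
    obtain ⟨L, hL, hl⟩ := hA.lipschitz' ht
    exact (isRegular_J hP hα hα1 ht ih).bestAction hα hα1 (hA.nonempty' ht) hL hl

/-! ### Existence of one-step optimizers -/

/-- Apply `exists_measurable_minimizer` on the graph to `-J`, with level minus the value function.
Off the graph the selector is set to `0`. -/
theorem exists_isOptimalSelector {Ψ : Hist Ωloc T → Acts m T → ℝ} (hA : ControlAssumption A T)
    {α : ℝ} (hα : 0 < α) {t : ℕ} (ht : t < T)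
    (hv : IsRegular A p α (Nat.le_succ _) (valueFn A P Ψ t ht.le))
    (hJ : IsRegular A p α le_rfl (J A P Ψ t ht)) : ∃ ã, IsOptimalSelector A P Ψ t ht ã := by
  have hle : ∀ z ∈ graph A t t (Nat.le_succ t), ∀ x ∈ A t z.1,
      J A P Ψ t ht z.1 (extActs z.2 x) ≤ valueFn A P Ψ t ht.le z.1 z.2 := fun z hz x hx => by
    rw [valueFn_step]
    exact le_ciSup (hJ.bddAbove_extActs hz) ⟨x, hx⟩
  obtain ⟨f, hf, hfm⟩ := exists_measurable_minimizer (X := graph A t t (Nat.le_succ t))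
    (F := fun z => A t z.1.1) (h := fun z x => -J A P Ψ t ht z.1.1 (extActs z.1.2 x))
    (v := fun z => -valueFn A P Ψ t ht.le z.1.1 z.1.2)
    -- The coordinates separate points; they are padded by zero to form an infinite sequence.
    (g := fun n (y : E (m t)) => if h : n < m t then y ⟨n, h⟩ else 0)
    (fun n => by split_ifs <;> fun_prop)
    (fun y y' h => by
      ext i
      simpa using h i)
    (fun z => hA.nonempty' ht _) (fun z => hA.compact' ht _)
    (upperHemicontinuous_comp (hA.upper' ht) (continuous_fst.comp continuous_subtype_val))
    (continuousOn_iff_continuous_domRestrict.1 (hv.continuousOn hα)).neg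
    ((hJ.continuousOn hα).comp
      (f := fun z : graph A t t (Nat.le_succ t) × E (m t) => (z.1.1.1, extActs z.1.1.2 z.2))
      (Continuous.continuousOn ((continuous_fst.comp (continuous_subtype_val.comp
        continuous_fst)).prodMk (continuous_extActs.comp ((continuous_snd.comp
        (continuous_subtype_val.comp continuous_fst)).prodMk continuous_snd))))
      (fun z hz => extActs_mem_graph.2 ⟨z.1.2, hz⟩)).neg
    (fun z b hb => by
      rw [le_neg, valueFn_step A P Ψ t ht]
      have := (hA.nonempty' ht z.1.1).to_subtype
      exact ciSup_le fun x => le_neg.1 (hb x x.2))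
  classical
  refine ⟨fun ω a => if h : (ω, a) ∈ graph A t t (Nat.le_succ t) then f ⟨(ω, a), h⟩ else 0,
    ?_, fun z hz => ?_, fun z hz => ?_⟩
  · have : (fun z : graph A t t (Nat.le_succ t) => if h : (z.1.1, z.1.2) ∈
        graph A t t (Nat.le_succ t) then f ⟨(z.1.1, z.1.2), h⟩ else 0) = f := by
      funext z
      exact dif_pos z.2
    rw [this]
    exact measurable_of_isClosed fun C hC => hfm C hC
  · rw [dif_pos hz]
    exact (hf ⟨z, hz⟩).1
  · rw [dif_pos hz]
    exact le_antisymm (neg_le_neg_iff.1 (hf ⟨z, hz⟩).2) (hle z hz _ (hf ⟨z, hz⟩).1)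

/-- One-step integrals depend continuously on the state, the action and the measure. -/
theorem IsRegular.continuous_integral {α : ℝ} (hα : 0 < α) {t : ℕ}
    {f : Hist Ωloc (t + 1) → Acts m (t + 1) → ℝ} (hf : IsRegular A p α (Nat.le_succ _) f) :
    Continuous fun z : graph A t (t + 1) le_rfl × MomentMeasure Ωloc p =>
      ∫ x, f (extHist z.1.1.1 x) z.1.1.2 ∂(z.2.1 : Measure Ωloc) := by
  obtain ⟨L, hL, hh⟩ := hf.holder
  refine continuous_iff_continuousAt.2 fun ⟨z, μ⟩ => ?_
  -- With the integrand frozen, this is continuity for `τ_p`. Unfreezing it costs at most `L` times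
  -- the Hölder distance, uniformly in `x` and in the probability measure.
  have h1 : Tendsto (fun w : graph A t (t + 1) le_rfl × MomentMeasure Ωloc p =>
      ∫ x, f (extHist z.1.1 x) z.1.2 ∂(w.2.1 : Measure Ωloc)) (𝓝 (z, μ))
      (𝓝 (∫ x, f (extHist z.1.1 x) z.1.2 ∂(μ.1 : Measure Ωloc))) :=
    ((continuous_integral_polyGrowth (hf.mem_polyGrowth hα z.2)).comp continuous_snd).tendsto _
  have h2 : Tendsto (fun w : graph A t (t + 1) le_rfl × MomentMeasure Ωloc p =>
      ∫ x, f (extHist w.1.1.1 x) w.1.1.2 ∂(w.2.1 : Measure Ωloc) -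
        ∫ x, f (extHist z.1.1 x) z.1.2 ∂(w.2.1 : Measure Ωloc)) (𝓝 (z, μ)) (𝓝 0) := by
    refine squeeze_zero_norm (a := fun w => L * holderDist α w.1.1 z.1) (fun w => ?_) ?_
    · rw [← integral_sub (hf.integrable hα w.1.2 w.2.2) (hf.integrable hα z.2 w.2.2)]
      refine (norm_integral_le_of_norm_le_const (C := L * holderDist α w.1.1 z.1)
        (Eventually.of_forall fun x => ?_)).trans_eq (by simp)
      have := hh (extHist w.1.1.1 x, w.1.1.2) (extHist_mem_graph.2 w.1.2)
        (extHist z.1.1 x, z.1.2) (extHist_mem_graph.2 z.2)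
      rw [holderDist_extHist] at this
      simpa [Real.zero_rpow hα.ne'] using this
    · have hc : Tendsto (fun w : graph A t (t + 1) le_rfl × MomentMeasure Ωloc p => w.1.1)
          (𝓝 (z, μ)) (𝓝 z.1) := (continuous_subtype_val.comp continuous_fst).tendsto _
      simpa using ((tendsto_holderDist hα z.1).comp hc).const_mul L
  have := h2.add h1
  simp only [sub_add_cancel, zero_add] at this
  exact this

theorem exists_isWorstCaseSelector {Ψ : Hist Ωloc T → Acts m T → ℝ}
    (hP : AmbiguityAssumption P T p) {α : ℝ} (hα : 0 < α) {t : ℕ} (ht : t < T)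
    (hv : IsRegular A p α (Nat.le_succ _) (valueFn A P Ψ (t + 1) ht))
    (hJ : IsRegular A p α le_rfl (J A P Ψ t ht)) : ∃ Q, IsWorstCaseSelector A P Ψ t ht Q := by
  obtain ⟨C, hC, hb⟩ := hP.moment_bound' ht
  obtain ⟨g, hg, hsep⟩ := exists_separating_momentMeasure (Ωloc := Ωloc) p
  obtain ⟨f, hf, hfm⟩ := exists_measurable_minimizer (X := graph A t (t + 1) le_rfl)
    (F := fun z => inMoment p (P t z.1.1))
    (h := fun z μ => ∫ x, valueFn A P Ψ (t + 1) ht (extHist z.1.1 x) z.1.2 ∂(μ.1 : Measure Ωloc))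
    (v := fun z => J A P Ψ t ht z.1.1 z.1.2) hg hsep
    (fun z => by
      obtain ⟨μ, hμ⟩ := hP.nonempty' ht z.1.1
      exact ⟨⟨μ, hP.moment' ht _ μ hμ⟩, hμ⟩)
    (fun z => hP.compact' ht _)
    (upperHemicontinuous_comp (hP.upper' ht) (continuous_fst.comp continuous_subtype_val))
    (continuousOn_iff_continuous_domRestrict.1 (hJ.continuousOn hα))
    (hv.continuous_integral hα).continuousOn
    (fun z b hb => by
      have := (hP.nonempty' ht z.1.1).to_subtype
      exact le_ciInf fun μ => hb ⟨μ.1, hP.moment' ht _ μ.1 μ.2⟩ μ.2)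
  -- The selection theorem controls only preimages of `τ_p`-closed sets. This suffices, because
  -- integrals of bounded continuous functions are `τ_p`-continuous.
  have hmeas : Measurable fun z => (f z).1 := by
    refine measurable_probabilityMeasure_of_integral fun g hg hg1 => ?_
    exact measurable_of_isClosed fun C hC => hfm _
      (hC.preimage (continuous_integral_polyGrowth (mem_polyGrowth_of_bounded hg hg1)))
  classical
  refine ⟨fun ω a => if h : (ω, a) ∈ graph A t (t + 1) le_rfl then (f ⟨(ω, a), h⟩).1
    else (hP.nonempty' ht ω).some, ?_, fun z hz => ?_, fun z hz => ?_⟩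
  · have : (fun z : graph A t (t + 1) le_rfl => if h : (z.1.1, z.1.2) ∈
        graph A t (t + 1) le_rfl then (f ⟨(z.1.1, z.1.2), h⟩).1
          else (hP.nonempty' ht z.1.1).some) = fun z => (f z).1 := by
      funext z
      exact dif_pos z.2
    rw [this]
    exact hmeas
  · rw [dif_pos hz]
    exact (hf ⟨z, hz⟩).1
  · rw [dif_pos hz]
    exact le_antisymm (hf ⟨z, hz⟩).2
      (ciInf_le (hv.bddBelow_integral hα (hP.moment' ht) hC hb hz) ⟨(f ⟨z, hz⟩).1, (hf ⟨z, hz⟩).1⟩)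

end Assumptions


open ProbabilityTheory

variable {d : ℕ} {Ωloc : Set (E d)} {m : ℕ → ℕ}

/-! ### Path measures as compositions of kernels -/

section PathMeasure

/-- A measurable family of probability measures as a Markov kernel. -/
def stepKernel {t : ℕ} (κ : Hist Ωloc t → ProbabilityMeasure Ωloc) (hκ : Measurable κ) :
    Kernel (Hist Ωloc t) Ωloc :=
  ⟨fun ω => (κ ω : Measure Ωloc), measurable_subtype_coe.comp hκ⟩

instance {t : ℕ} (κ : Hist Ωloc t → ProbabilityMeasure Ωloc) (hκ : Measurable κ) :
    IsMarkovKernel (stepKernel κ hκ) :=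
  ⟨fun ω => inferInstanceAs (IsProbabilityMeasure (κ ω : Measure Ωloc))⟩

variable {K : (t : ℕ) → Hist Ωloc t → ProbabilityMeasure Ωloc}

/-- Writing the step as the image of a kernel product makes Fubini's theorem for kernels available.
-/
theorem pathMeasure_succ {t : ℕ} [SFinite (pathMeasure K t)] (hK : Measurable (K t)) :
    pathMeasure K (t + 1) = ((pathMeasure K t).compProd (stepKernel (K t) hK)).map
      fun z => extHist z.1 z.2 := by
  have hm : Measurable fun z : Hist Ωloc t × Ωloc => extHist z.1 z.2 :=
    continuous_extHist.measurable
  rw [Measure.compProd_eq_comp_prod, Measure.map_comp _ _ hm]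
  change (pathMeasure K t).bind _ = (pathMeasure K t).bind _
  congr 1
  funext ω
  rw [Kernel.map_apply _ hm, Kernel.prod_apply, Kernel.id_apply, Measure.dirac_prod,
    Measure.map_map hm (by fun_prop)]
  rfl

theorem isProbabilityMeasure_pathMeasure {t : ℕ} (hK : ∀ s < t, Measurable (K s)) :
    IsProbabilityMeasure (pathMeasure K t) := by
  induction t with
  | zero => exact Measure.dirac.isProbabilityMeasure
  | succ t ih =>
    have := ih fun s hs => hK s (hs.trans t.lt_succ_self)
    rw [pathMeasure_succ (hK t t.lt_succ_self)]
    exact Measure.isProbabilityMeasure_map continuous_extHist.measurable.aemeasurable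

theorem integral_pathMeasure_succ {t : ℕ} (hK : ∀ s < t + 1, Measurable (K s))
    {f : Hist Ωloc (t + 1) → ℝ} (hf : Integrable f (pathMeasure K (t + 1))) :
    Integrable (fun ω => ∫ x, f (extHist ω x) ∂(K t ω : Measure Ωloc)) (pathMeasure K t) ∧
      ∫ ω, f ω ∂(pathMeasure K (t + 1)) =
        ∫ ω, ∫ x, f (extHist ω x) ∂(K t ω : Measure Ωloc) ∂(pathMeasure K t) := by
  have hp := isProbabilityMeasure_pathMeasure fun s hs => hK s (Nat.lt_succ_of_lt hs)
  have hm : Measurable fun z : Hist Ωloc t × Ωloc => extHist z.1 z.2 :=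
    continuous_extHist.measurable
  rw [pathMeasure_succ (hK t t.lt_succ_self)] at hf ⊢
  have hf' := hf.comp_measurable hm
  refine ⟨?_, ?_⟩
  · rw [Measure.compProd] at hf'
    exact hf'.integral_compProd
  · rw [integral_map hm.aemeasurable hf.aestronglyMeasurable]
    exact Measure.integral_compProd hf'

/-- The moments of path measures are bounded uniformly over all admissible kernels. -/
theorem exists_moment_bound_pathMeasure {P : (t : ℕ) → Hist Ωloc t → Set (ProbabilityMeasure Ωloc)}
    {T p : ℕ} (hP : AmbiguityAssumption P T p) {t : ℕ} (ht : t ≤ T) :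
    ∃ M : ℝ, ∀ K ∈ kernels P T,
      Integrable (fun ω : Hist Ωloc t => ∑ i, ‖(ω i : E d)‖ ^ p) (pathMeasure K t) ∧
      ∫ ω : Hist Ωloc t, ∑ i, ‖(ω i : E d)‖ ^ p ∂(pathMeasure K t) ≤ M := by
  induction t with
  | zero => exact ⟨0, fun K hK => by simp⟩
  | succ t ih =>
    obtain ⟨M, hM⟩ := ih (Nat.le_of_succ_le ht)
    obtain ⟨C, hC, hb⟩ := hP.moment_bound' ht
    -- The earlier observations contribute `M`; the conditional moment bound, averaged over the
    -- past, contributes `C * (1 + M)`.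
    refine ⟨M + C * (1 + M), fun K hK => ?_⟩
    obtain ⟨hint, hle⟩ := hM K hK
    have hKm : ∀ s < t + 1, Measurable (K s) := fun s hs => (hK s (by omega)).1
    have hp := isProbabilityMeasure_pathMeasure fun s hs => hKm s (Nat.lt_succ_of_lt hs)
    have hm : Measurable fun z : Hist Ωloc t × Ωloc => extHist z.1 z.2 :=
      continuous_extHist.measurable
    have hmom : ∀ ω, Integrable (fun x : Ωloc => ‖(x : E d)‖ ^ p) (K t ω : Measure Ωloc) :=
      fun ω => hP.moment' ht ω _ ((hK t ht).2 ω)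
    have hinner : ∀ ω : Hist Ωloc t, ∫ x, ∑ i, ‖(extHist ω x i : E d)‖ ^ p ∂(K t ω : Measure Ωloc) =
        ∑ i, ‖(ω i : E d)‖ ^ p + ∫ x, ‖(x : E d)‖ ^ p ∂(K t ω : Measure Ωloc) := fun ω => by
      simp only [Fin.sum_univ_castSucc, extHist_castSucc, extHist_last]
      rw [integral_add (integrable_const _) (hmom ω)]
      simp
    have hbound : Integrable (fun ω : Hist Ωloc t => C * (1 + ∑ i, ‖(ω i : E d)‖ ^ p))
        (pathMeasure K t) := ((integrable_const _).add hint).const_mul C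
    have hdom : Integrable (fun ω : Hist Ωloc t => ∑ i, ‖(ω i : E d)‖ ^ p +
        C * (1 + ∑ i, ‖(ω i : E d)‖ ^ p)) (pathMeasure K t) :=
      hint.add hbound
    have hcont : Continuous fun ω : Hist Ωloc (t + 1) => ∑ i, ‖(ω i : E d)‖ ^ p := by fun_prop
    have hint' : Integrable (fun ω : Hist Ωloc (t + 1) => ∑ i, ‖(ω i : E d)‖ ^ p)
        (pathMeasure K (t + 1)) := by
      rw [pathMeasure_succ (hKm t t.lt_succ_self),
        integrable_map_measure hcont.aestronglyMeasurable hm.aemeasurable,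
        Measure.integrable_compProd_iff (hcont.comp continuous_extHist).aestronglyMeasurable]
      refine ⟨Eventually.of_forall fun ω => ?_, ?_⟩
      · simp only [Function.comp_apply, Fin.sum_univ_castSucc, extHist_castSucc, extHist_last]
        exact (integrable_const _).add (hmom ω)
      · refine hdom.mono' ?_ (Eventually.of_forall fun ω => ?_)
        · exact ((hcont.comp continuous_extHist).norm.stronglyMeasurable.integral_kernel_prod_right'
            (κ := stepKernel (K t) _)).aestronglyMeasurable
        · rw [Real.norm_of_nonneg (integral_nonneg fun x => norm_nonneg _)]
          have h0 : ∀ x, ‖((fun ω : Hist Ωloc (t + 1) => ∑ i, ‖(ω i : E d)‖ ^ p) ∘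
              fun z : Hist Ωloc t × Ωloc => extHist z.1 z.2) (ω, x)‖ =
              ∑ i, ‖(extHist ω x i : E d)‖ ^ p := fun x =>
            Real.norm_of_nonneg (by simp only [Function.comp_apply]; positivity)
          simp only [h0]
          refine (hinner ω).trans_le ?_
          gcongr
          exact hb ω _ ((hK t ht).2 ω)
    refine ⟨hint', ?_⟩
    obtain ⟨h1, h2⟩ := integral_pathMeasure_succ hKm hint'
    rw [h2]
    calc _ ≤ ∫ ω : Hist Ωloc t, (∑ i, ‖(ω i : E d)‖ ^ p +
        C * (1 + ∑ i, ‖(ω i : E d)‖ ^ p)) ∂(pathMeasure K t) := by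
          refine integral_mono h1 hdom fun ω => (hinner ω).trans_le ?_
          gcongr
          exact hb ω _ ((hK t ht).2 ω)
      _ = ∫ ω : Hist Ωloc t, ∑ i, ‖(ω i : E d)‖ ^ p ∂(pathMeasure K t) +
          C * (1 + ∫ ω : Hist Ωloc t, ∑ i, ‖(ω i : E d)‖ ^ p ∂(pathMeasure K t)) := by
          rw [integral_add hint hbound, integral_const_mul, integral_add (integrable_const _) hint]
          simp
      _ ≤ _ := by gcongr

end PathMeasure

/-! ### Actions along histories -/

section Along

variable {A : (t : ℕ) → Hist Ωloc t → Set (E (m t))}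
  {P : (t : ℕ) → Hist Ωloc t → Set (ProbabilityMeasure Ωloc)} {T p : ℕ}
  {a : (t : ℕ) → Hist Ωloc t → E (m t)}

theorem measurable_pre {t : ℕ} (k : ℕ) (h : k ≤ t) :
    Measurable fun ω : Hist Ωloc t => pre ω k h :=
  measurable_pi_lambda _ fun _ => measurable_pi_apply _

theorem measurable_along {t : ℕ} (ha : ∀ s < t, Measurable (a s)) : Measurable (along a t) :=
  measurable_pi_lambda _ fun i => (ha i i.isLt).comp (measurable_pre _ _)

theorem along_mem_graph {t : ℕ} (ha : ∀ s < t, ∀ ω, a s ω ∈ A s ω) (ω : Hist Ωloc t) :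
    (ω, along a t ω) ∈ graph A t t (Nat.le_succ t) := fun i => ha i i.isLt _

theorem extActs_along_mem_graph {t : ℕ} (ha : ∀ s < t + 1, ∀ ω, a s ω ∈ A s ω) (ω : Hist Ωloc t) :
    (ω, extActs (along a t ω) (a t ω)) ∈ graph A t (t + 1) le_rfl :=
  extActs_mem_graph.2 ⟨along_mem_graph (fun s hs => ha s (Nat.lt_succ_of_lt hs)) ω,
    ha t t.lt_succ_self ω⟩

theorem measurable_extActs_along {t : ℕ} (ha : ∀ s < t + 1, Measurable (a s)) :
    Measurable fun ω => extActs (along a t ω) (a t ω) :=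
  continuous_extActs.measurable.comp
    ((measurable_along fun s hs => ha s (Nat.lt_succ_of_lt hs)).prodMk (ha t t.lt_succ_self))

theorem along_extHist {t : ℕ} (ω : Hist Ωloc t) (x : Ωloc) :
    along a (t + 1) (extHist ω x) = extActs (along a t ω) (a t ω) := by
  funext i
  refine Fin.lastCases ?_ (fun i => ?_) i
  · rw [extActs_last]
    exact congrArg (a t) (pre_extHist ω x t le_rfl _)
  · rw [extActs_castSucc]
    exact congrArg (a i) (pre_extHist ω x i i.isLt.le _)

/-- Regularity says nothing off the graph, so measurability is obtained by factoring through the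
graph as a subtype. -/
theorem IsRegular.integrable_comp {α : ℝ} (hα : 0 < α) {t s : ℕ} {h : s ≤ t + 1}
    {f : Hist Ωloc t → Acts m s → ℝ} (hf : IsRegular A p α h f) {b : Hist Ωloc t → Acts m s}
    (hb : Measurable b) (hmem : ∀ ω, (ω, b ω) ∈ graph A t s h) {μ : Measure (Hist Ωloc t)}
    [IsFiniteMeasure μ] (hμ : Integrable (fun ω : Hist Ωloc t => ∑ i, ‖(ω i : E d)‖ ^ p) μ) :
    Integrable (fun ω => f ω (b ω)) μ := by
  obtain ⟨C, hC, hg⟩ := hf.growth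
  have hc := (continuousOn_iff_continuous_domRestrict.1 (hf.continuousOn hα)).measurable.comp
    ((measurable_id.prodMk hb).subtype_mk (h := hmem))
  exact (((integrable_const (1 : ℝ)).add hμ).const_mul C).mono' hc.aestronglyMeasurable
    (Eventually.of_forall fun ω => hg _ (hmem ω))

variable {Ψ : Hist Ωloc T → Acts m T → ℝ}

/-- Measurability and admissibility must be proved in one strong induction: the selector is
measurable only on the graph, which the earlier actions must be known to reach. -/
theorem composeControl_mem_controls
    {ã : (t : ℕ) → Hist Ωloc t → Acts m t → E (m t)}
    (hã : ∀ t (ht : t < T), IsOptimalSelector A P Ψ t ht (ã t)) :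
    composeControl ã ∈ controls A T := by
  intro t
  induction t using Nat.strong_induction_on with
  | _ t ih =>
    intro ht
    have hmem : ∀ ω, (ω, along (composeControl ã) t ω) ∈ graph A t t (Nat.le_succ t) :=
      along_mem_graph fun s hs => (ih s hs (hs.trans ht)).2
    have heq : composeControl ã t = fun ω => ã t ω (along (composeControl ã) t ω) :=
      funext (composeControl_eq ã t)
    rw [heq]
    refine ⟨?_, fun ω => (hã t ht).mem _ (hmem ω)⟩
    exact (hã t ht).measurable.comp ((measurable_id.prodMk
      (measurable_along fun s hs => (ih s hs (hs.trans ht)).1)).subtype_mk (h := hmem))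

theorem composeKernel_mem_kernels
    {Q : (t : ℕ) → Hist Ωloc t → Acts m (t + 1) → ProbabilityMeasure Ωloc}
    (hQ : ∀ t (ht : t < T), IsWorstCaseSelector A P Ψ t ht (Q t)) (ha : a ∈ controls A T) :
    composeKernel Q a ∈ kernels P T := by
  intro t ht
  have hmem := extActs_along_mem_graph (t := t) fun s hs => (ha s (by omega)).2
  refine ⟨?_, fun ω => (hQ t ht).mem _ (hmem ω)⟩
  exact (hQ t ht).measurable.comp ((measurable_id.prodMk
    (measurable_extActs_along fun s hs => (ha s (by omega)).1)).subtype_mk (h := hmem))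

/-! ### Verification -/

variable {K : (t : ℕ) → Hist Ωloc t → ProbabilityMeasure Ωloc}

theorem integrable_valueFn_along (hA : ControlAssumption A T) (hΨ : ObjectiveAssumption A T p Ψ)
    (hP : AmbiguityAssumption P T p) (ha : a ∈ controls A T) (hK : K ∈ kernels P T) {t : ℕ}
    (ht : t ≤ T) : Integrable (fun ω => valueFn A P Ψ t ht ω (along a t ω)) (pathMeasure K t) := by
  obtain ⟨α, hα, hα1, hreg⟩ := isRegular_objective hΨ
  obtain ⟨M, hM⟩ := exists_moment_bound_pathMeasure hP ht
  have := isProbabilityMeasure_pathMeasure (t := t) fun s hs => (hK s (by omega)).1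
  exact (isRegular_valueFn hA hP hα hα1 hreg ht).integrable_comp hα
    (measurable_along fun s hs => (ha s (by omega)).1)
    (along_mem_graph fun s hs => (ha s (by omega)).2) (hM K hK).1

/-- The tower property. The actions up to time `t` are fixed before the next observation is drawn,
so they are constant in the inner integral. -/
theorem integral_valueFn_succ (hA : ControlAssumption A T) (hΨ : ObjectiveAssumption A T p Ψ)
    (hP : AmbiguityAssumption P T p) (ha : a ∈ controls A T) (hK : K ∈ kernels P T) {t : ℕ}
    (ht : t < T) :
    Integrable (fun ω => ∫ x, valueFn A P Ψ (t + 1) ht (extHist ω x)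
      (extActs (along a t ω) (a t ω)) ∂(K t ω : Measure Ωloc)) (pathMeasure K t) ∧
    ∫ ω, valueFn A P Ψ (t + 1) ht ω (along a (t + 1) ω) ∂(pathMeasure K (t + 1)) =
      ∫ ω, ∫ x, valueFn A P Ψ (t + 1) ht (extHist ω x) (extActs (along a t ω) (a t ω))
        ∂(K t ω : Measure Ωloc) ∂(pathMeasure K t) := by
  have := integral_pathMeasure_succ (K := K) (t := t) (fun s hs => (hK s (by omega)).1)
    (integrable_valueFn_along hA hΨ hP ha hK ht)
  simpa only [along_extHist] using this

theorem integral_valueFn_zero (ht : 0 ≤ T) :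
    ∫ ω, valueFn A P Ψ 0 ht ω (along a 0 ω) ∂(pathMeasure K 0) = value A P Ψ := by
  rw [pathMeasure, integral_dirac, value, Subsingleton.elim (along a 0 default) default]

/-- Against a worst case kernel, no control does better than `Ψ_0`. -/
theorem expectedObjective_composeKernel_le (hA : ControlAssumption A T)
    (hΨ : ObjectiveAssumption A T p Ψ) (hP : AmbiguityAssumption P T p)
    {Q : (t : ℕ) → Hist Ωloc t → Acts m (t + 1) → ProbabilityMeasure Ωloc}
    (hQ : ∀ t (ht : t < T), IsWorstCaseSelector A P Ψ t ht (Q t)) (ha : a ∈ controls A T) :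
    expectedObjective Ψ (pathMeasure (composeKernel Q a) T) a ≤ value A P Ψ := by
  obtain ⟨α, hα, hα1, hreg⟩ := isRegular_objective hΨ
  have hK := composeKernel_mem_kernels hQ ha
  have key : ∀ t (ht : t ≤ T), ∫ ω, valueFn A P Ψ t ht ω (along a t ω)
      ∂(pathMeasure (composeKernel Q a) t) ≤ value A P Ψ := by
    intro t
    induction t with
    | zero => exact fun ht => (integral_valueFn_zero ht).le
    | succ t ih =>
      intro ht
      refine le_trans ?_ (ih (Nat.le_of_succ_le ht))
      obtain ⟨h1, h2⟩ := integral_valueFn_succ hA hΨ hP ha hK ht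
      rw [h2]
      -- Pointwise, the worst-case kernel turns the inner integral into `J_t` at the action played,
      -- which is at most its supremum `Ψ_t`.
      refine integral_mono h1 (integrable_valueFn_along hA hΨ hP ha hK _) fun ω => ?_
      have hmem := extActs_along_mem_graph (t := t) (fun s hs => (ha s (by omega)).2) ω
      have hmem' := along_mem_graph (t := t) (fun s hs => (ha s (by omega)).2) ω
      have hJ := isRegular_J hP hα hα1 ht (isRegular_valueFn hA hP hα hα1 hreg ht)
      refine ((hQ t ht).worst _ hmem).trans_le ?_
      rw [valueFn_step A P Ψ t ht]
      exact le_ciSup (hJ.bddAbove_extActs hmem') ⟨a t ω, (ha t ht).2 ω⟩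
  simpa only [valueFn_last, expectedObjective] using key T le_rfl

/-- The composed optimal control guarantees `Ψ_0` against all admissible measures. -/
theorem value_le_expectedObjective (hA : ControlAssumption A T)
    (hΨ : ObjectiveAssumption A T p Ψ) (hP : AmbiguityAssumption P T p)
    {ã : (t : ℕ) → Hist Ωloc t → Acts m t → E (m t)}
    (hã : ∀ t (ht : t < T), IsOptimalSelector A P Ψ t ht (ã t)) (hK : K ∈ kernels P T) :
    value A P Ψ ≤ expectedObjective Ψ (pathMeasure K T) (composeControl ã) := by
  obtain ⟨α, hα, hα1, hreg⟩ := isRegular_objective hΨ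
  have ha := composeControl_mem_controls hã
  have key : ∀ t (ht : t ≤ T), value A P Ψ ≤
      ∫ ω, valueFn A P Ψ t ht ω (along (composeControl ã) t ω) ∂(pathMeasure K t) := by
    intro t
    induction t with
    | zero => exact fun ht => (integral_valueFn_zero ht).ge
    | succ t ih =>
      intro ht
      refine (ih (Nat.le_of_succ_le ht)).trans ?_
      obtain ⟨h1, h2⟩ := integral_valueFn_succ hA hΨ hP ha hK ht
      rw [h2]
      -- Pointwise, `Ψ_t` equals `J_t` at the optimal action, an infimum that the integral under `K
      -- t ω` cannot undercut.
      refine integral_mono (integrable_valueFn_along hA hΨ hP ha hK _) h1 fun ω => ?_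
      have hmem := extActs_along_mem_graph (t := t) (fun s hs => (ha s (by omega)).2) ω
      have hmem' := along_mem_graph (t := t) (fun s hs => (ha s (by omega)).2) ω
      obtain ⟨C, hC, hb⟩ := hP.moment_bound' ht
      refine ((hã t ht).optimal _ hmem').trans_le ?_
      rw [← composeControl_eq ã t ω]
      exact ciInf_le ((isRegular_valueFn hA hP hα hα1 hreg ht).bddBelow_integral hα
        (hP.moment' ht) hC hb hmem) ⟨K t ω, (hK t ht).2 ω⟩
  simpa only [valueFn_last, expectedObjective] using key T le_rfl

/-- Growth of `Ψ` and the moment bound `M`, uniform over kernels, give one bound for all admissible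
measures. Without it, the real-valued infimum could not be compared with its members. -/
theorem bddBelow_expectedObjective (hΨ : ObjectiveAssumption A T p Ψ)
    (hP : AmbiguityAssumption P T p) (ha : a ∈ controls A T) :
    BddBelow (Set.range fun μ : measures P T => expectedObjective Ψ μ a) := by
  obtain ⟨C, hC, hg⟩ := hΨ.growth
  obtain ⟨M, hM⟩ := exists_moment_bound_pathMeasure hP le_rfl
  refine ⟨-(C * (1 + M)), ?_⟩
  rintro _ ⟨⟨_, K, hK, rfl⟩, rfl⟩
  have := isProbabilityMeasure_pathMeasure (t := T) fun s hs => (hK s hs).1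
  refine (abs_le.1 ?_).1
  have hint : Integrable (fun ω : Hist Ωloc T => C * (1 + ∑ i, ‖(ω i : E d)‖ ^ p))
      (pathMeasure K T) := ((integrable_const _).add (hM K hK).1).const_mul C
  refine (norm_integral_le_of_norm_le (f := fun ω => Ψ ω (along a T ω)) hint
    (Eventually.of_forall fun ω => hg _ (along_mem_graph (fun s hs => (ha s hs).2) ω))).trans ?_
  rw [integral_const_mul, integral_add (integrable_const _) (hM K hK).1]
  simp only [integral_const, probReal_univ, smul_eq_mul, mul_one]
  have := (hM K hK).2
  gcongr

end Along

end RobustControl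

end

/-! ### The dynamic programming theorem. -/

theorem theorem3p1 {d : ℕ} (Ωloc : Set (RobustControl.E d)) (hΩ : IsClosed Ωloc)
    (T : ℕ) (hT : 1 ≤ T) (m : ℕ → ℕ)
    (A : (t : ℕ) → RobustControl.Hist Ωloc t → Set (RobustControl.E (m t)))
    (P : (t : ℕ) → RobustControl.Hist Ωloc t → Set (ProbabilityMeasure Ωloc))
    (p : ℕ) (Ψ : RobustControl.Hist Ωloc T → RobustControl.Acts m T → ℝ)
    (hA : RobustControl.ControlAssumption A T)
    (hΨ : RobustControl.ObjectiveAssumption A T p Ψ)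
    (hP : RobustControl.AmbiguityAssumption P T p) :
    RobustControl.WellPosed A P Ψ ∧
    (∀ t (ht : t < T),
      (∃ ã, RobustControl.IsOptimalSelector A P Ψ t ht ã) ∧
      (∃ Q, RobustControl.IsWorstCaseSelector A P Ψ t ht Q)) ∧
    (∀ (ã : (t : ℕ) → RobustControl.Hist Ωloc t → RobustControl.Acts m t → RobustControl.E (m t))
      (Q : (t : ℕ) → RobustControl.Hist Ωloc t → RobustControl.Acts m (t + 1) →
        ProbabilityMeasure Ωloc),
      (∀ t (ht : t < T), RobustControl.IsOptimalSelector A P Ψ t ht (ã t)) →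
      (∀ t (ht : t < T), RobustControl.IsWorstCaseSelector A P Ψ t ht (Q t)) →
      ∀ aStar PStar, aStar = RobustControl.composeControl ã →
        PStar = RobustControl.composeKernel Q aStar →
        aStar ∈ RobustControl.controls A T ∧
        PStar ∈ RobustControl.kernels P T ∧
        RobustControl.pathMeasure PStar T ∈ RobustControl.measures P T ∧
        (⨆ a : RobustControl.controls A T, ⨅ μ : RobustControl.measures P T,
            RobustControl.expectedObjective Ψ (μ : Measure _) (a : (t : ℕ) → _)) =
          (⨅ μ : RobustControl.measures P T,
            RobustControl.expectedObjective Ψ (μ : Measure _) aStar) ∧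
        (⨅ μ : RobustControl.measures P T,
            RobustControl.expectedObjective Ψ (μ : Measure _) aStar) =
          RobustControl.expectedObjective Ψ (RobustControl.pathMeasure PStar T) aStar ∧
        RobustControl.expectedObjective Ψ (RobustControl.pathMeasure PStar T) aStar =
          RobustControl.value A P Ψ) := by
  open RobustControl in
  obtain ⟨α, hα, hα1, hreg⟩ := isRegular_objective hΨ
  have hV := fun t (ht : t ≤ T) => isRegular_valueFn hA hP hα hα1 hreg ht
  have hJ := fun t (ht : t < T) => isRegular_J hP hα hα1 ht (hV (t + 1) ht)
  have hsel : ∀ t (ht : t < T), (∃ ã, IsOptimalSelector A P Ψ t ht ã) ∧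
      (∃ Q, IsWorstCaseSelector A P Ψ t ht Q) := fun t ht =>
    ⟨exists_isOptimalSelector hA hα ht (hV t ht.le) (hJ t ht),
      exists_isWorstCaseSelector hP hα ht (hV (t + 1) ht) (hJ t ht)⟩
  have hle : ∀ (Q : (t : ℕ) → Hist Ωloc t → Acts m (t + 1) → ProbabilityMeasure Ωloc),
      (∀ t (ht : t < T), IsWorstCaseSelector A P Ψ t ht (Q t)) → ∀ a ∈ controls A T,
      (⨅ μ : measures P T, expectedObjective Ψ (μ : Measure _) a) ≤ value A P Ψ :=
    fun Q hQ a ha => (ciInf_le (bddBelow_expectedObjective hΨ hP ha)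
      ⟨_, _, composeKernel_mem_kernels hQ ha, rfl⟩).trans
      (expectedObjective_composeKernel_le hA hΨ hP hQ ha)
  have hbdd : BddAbove (Set.range fun a : controls A T =>
      ⨅ μ : measures P T, expectedObjective Ψ (μ : Measure _) (a : (t : ℕ) → _)) := by
    -- Composing kernels requires a family indexed by all times; from `T` on, any constant measure
    -- will do.
    have hQ : ∀ t, ∃ Q, ∀ ht : t < T, IsWorstCaseSelector A P Ψ t ht Q := fun t => by
      by_cases ht : t < T
      · obtain ⟨Q, hQ⟩ := (hsel t ht).2
        exact ⟨Q, fun _ => hQ⟩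
      · obtain ⟨μ, -⟩ := hP.nonempty_zero default
        exact ⟨fun _ _ => μ, fun h => absurd h ht⟩
    choose Q hQ using hQ
    refine ⟨value A P Ψ, ?_⟩
    rintro _ ⟨a, rfl⟩
    exact hle Q hQ a a.2
  refine ⟨⟨fun t ht z hz μ hμ => (hV (t + 1) ht).integrable hα hz (hP.moment' ht _ μ hμ),
    fun t ht z hz => ?_, fun t ht z hz => (hJ t ht).bddAbove_extActs hz, ?_,
    fun a ha => bddBelow_expectedObjective hΨ hP ha, hbdd⟩, hsel, ?_⟩
  · obtain ⟨C, hC, hb⟩ := hP.moment_bound' ht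
    exact (hV (t + 1) ht).bddBelow_integral hα (hP.moment' ht) hC hb hz
  · rintro a ha _ ⟨K, hK, rfl⟩
    simpa only [valueFn_last] using integrable_valueFn_along hA hΨ hP ha hK le_rfl
  · rintro ã Q hã hQ _ _ rfl rfl
    have ha := composeControl_mem_controls hã
    have hK := composeKernel_mem_kernels hQ ha
    have hmem : pathMeasure (composeKernel Q (composeControl ã)) T ∈ measures P T := ⟨_, hK, rfl⟩
    have hne : Nonempty (measures P T) := ⟨⟨_, hmem⟩⟩
    have hne' : Nonempty (controls A T) := ⟨⟨_, ha⟩⟩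
    have h1 : expectedObjective Ψ (pathMeasure (composeKernel Q (composeControl ã)) T)
        (composeControl ã) = value A P Ψ :=
      le_antisymm (expectedObjective_composeKernel_le hA hΨ hP hQ ha)
        (value_le_expectedObjective hA hΨ hP hã hK)
    have h2 : (⨅ μ : measures P T, expectedObjective Ψ (μ : Measure _) (composeControl ã)) =
        value A P Ψ := by
      refine le_antisymm (hle Q hQ _ ha) (le_ciInf ?_)
      rintro ⟨_, K, hK', rfl⟩
      exact value_le_expectedObjective hA hΨ hP hã hK'
    refine ⟨ha, hK, hmem, ?_, h2.trans h1.symm, h1⟩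
    exact le_antisymm (ciSup_le fun a => (hle Q hQ a a.2).trans h2.ge)
      (le_ciSup hbdd ⟨_, ha⟩)
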